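/- **Definitions.** An *undirected graph with legs* consists of finite sets $E$ (edges) and $V$ (vertices) and a function $\mathrm{nbhd}:V\to\mathcal P(E)$ such that every edge lies in $\mathrm{nbhd}(v)$ for at most two $v$; an edge is *interior* if it lies in $\mathrm{nbhd}(v)\cap\mathrm{nbhd}(w)$ for some $v\ne w$, and otherwise it is a *leg*. The graph is *contractible* if its incidence graph (with node set $E\sqcup V$, and $e$ joined to $v$ when $e\in\mathrm{nbhd}(v)$) is a nonempty connected graph without cycles. A *tree* is a contractible graph with legs which has at least one leg, together with a total order on each set $\mathrm{nbhd}(v)$ and on the set of legs (if there is no vertex, the latter order is replaced by the unique map from $\{0,1\}$ to the single edge). A *subgraph* of a tree $S$ is a pair $(V',E')$ with $V'\subseteq V(S)$, $E'\subseteq E(S)$ and $\mathrm{nbhd}(v)\subseteq E'$ for all $v\in V'$, such that $(E',V',\mathrm{nbhd})$ is contractible. The *boundary* $\eth(T)$ of a subgraph $T$ is the multiset of its legs, each taken once, except that the boundary of a single edge $e$ (without vertices) is $\{e,e\}$. Two subgraphs *overlap* if they have a common edge or vertex; then their intersection and union are again subgraphs. For a vertex $v$, let $\bigstar_v$ be the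 subgraph $(\{v\},\mathrm{nbhd}(v))$. The objects of the category $\Xi$ are the trees. A morphism $\phi:R\to S$ consists of a function $\phi_0:E(R)\to E(S)$ and a function $\phi_1$ from the subgraphs of $R$ to the subgraphs of $S$ such that $\eth(\phi_1(T))=\phi_0(\eth(T))$ (as multisets) for every $T$, and such that, whenever $T,T'$ overlap, so do $\phi_1(T),\phi_1(T')$, and $\phi_1(T\cap T')=\phi_1(T)\cap\phi_1(T')$, $\phi_1(T\cup T')=\phi_1(T)\cup\phi_1(T')$. Composition is composition of functions. Let $d(S)=|V(S)|$. Let $\Xi^+$ be the class of the morphisms with $\phi_0$ injective, and $\Xi^-$ the class of the morphisms $\phi:R\to S$ with $\phi_0$ surjective and such that every vertex of $S$ is a vertex of $\phi_1(\bigstar_w)$ for some vertex $w$ of $R$. **Theorem.** The category $\Xi$ is essentially small and, with the degree function $d$, it is an EZ-category, that is: 1. a monomorphism preserves the degree if and only if it is invertible, and strictly raises the degree if and only if it is not invertible; 2. every morphism factors as a split epimorphism followed by a monomorphism; 3. any two split epimorphisms with a common domain admit an absolute pushout (they can be completed to a pushout square which every functor to any category sends to a pushout square). Moreover, $\Xi^+$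 is exactly the class of monomorphisms of $\Xi$, $\Xi^-$ is exactly the class of split epimorphisms of $\Xi$, and $(\Xi^+,\Xi^-,d)$ is a dualizable generalized Reedy structure on $\Xi$, that is: $\Xi^+$ and $\Xi^-$ are wide subcategories; non-invertible morphisms in $\Xi^+$ (resp. $\Xi^-$) strictly raise (resp. lower) the degree, and isomorphisms preserve it; the morphisms that lie in both $\Xi^+$ and $\Xi^-$ are exactly the isomorphisms; every morphism $f$ factors as $f=gh$ with $g\in\Xi^+$ and $h\in\Xi^-$, and for any other such factorization $f=g'h'$ there is an isomorphism $\theta$ with $\theta h=h'$ and $g=g'\theta$; and if $\theta$ is an isomorphism with $\theta f=f$ for some $f\in\Xi^-$, or with $f\theta=f$ for some $f\in\Xi^+$, then $\theta$ is an identity. -/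

import Mathlib

open CategoryTheory

universe u v w₁ w₂

noncomputable section

/-! ### Graphs with legs -/

/-- An undirected graph with legs: finite sets of edges and vertices, and for every vertex the set
of edges adjacent to it, such that every edge is adjacent to at most two vertices. -/
structure LegGraph where
  Edge : Type u
  Vertex : Type u
  finite_edge : Finite Edge
  finite_vertex : Finite Vertex
  nbhd : Vertex → Set Edge
  ncard_le_two : ∀ e : Edge, {x : Vertex | e ∈ nbhd x}.ncard ≤ 2

namespace LegGraph

attribute [instance] LegGraph.finite_edge LegGraph.finite_vertex

/-- The interior edges: those adjacent to two distinct vertices. -/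
def interior (G : LegGraph.{u}) : Set G.Edge :=
  {e | ∃ x y : G.Vertex, x ≠ y ∧ e ∈ G.nbhd x ∧ e ∈ G.nbhd y}

/-- The legs: the edges that are not interior. -/
def legs (G : LegGraph.{u}) : Set G.Edge := (G.interior)ᶜ

/-- The incidence graph: its nodes are the edges and the vertices of `G`, and an edge is joined to
the vertices adjacent to it. It is a one-dimensional complex homotopy equivalent to the space
underlying `G` (an interior edge is subdivided at its midpoint, a leg ends in its own node). -/
def incidence (G : LegGraph.{u}) : SimpleGraph (G.Edge ⊕ G.Vertex) :=
  SimpleGraph.fromRel fun a b => ∃ e x, a = Sum.inl e ∧ b = Sum.inr x ∧ e ∈ G.nbhd x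

lemma incidence_adj (G : LegGraph.{u}) {e : G.Edge} {x : G.Vertex} (h : e ∈ G.nbhd x) :
    G.incidence.Adj (Sum.inl e) (Sum.inr x) := by
  rw [incidence, SimpleGraph.fromRel_adj]
  exact ⟨by simp, Or.inl ⟨e, x, rfl, rfl, h⟩⟩

/-- A graph with legs is contractible when its incidence graph is a tree
(that is, nonempty, connected and without cycles). -/
def Contractible (G : LegGraph.{u}) : Prop := G.incidence.IsTree

end LegGraph

/-! ### Trees -/

/-- A (pinned, unrooted) tree: a contractible graph with legs, with at least one leg, with a total
order on the set of edges adjacent to each vertex, and with a total order on the set of legs (when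
there is no vertex, the latter is replaced by the unique map from a two-element ordered set to the
single edge). -/
structure XiTree extends LegGraph.{u} where
  contractible : toLegGraph.Contractible
  legs_nonempty : toLegGraph.legs.Nonempty
  ordAt : ∀ x : Vertex, Fin (toLegGraph.nbhd x).ncard ≃ toLegGraph.nbhd x
  numLegs : ℕ
  ord : Fin numLegs → toLegGraph.legs
  ord_bijective : Nonempty Vertex → Function.Bijective ord
  numLegs_eq_two : IsEmpty Vertex → numLegs = 2

/-- The set of nodes of the incidence graph given by a set of edges and a set of vertices. -/
def nodeSet {α β : Type*} (E : Set α) (V : Set β) : Set (α ⊕ β) :=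
  {a | Sum.elim (fun e => e ∈ E) (fun x => x ∈ V) a}

lemma nodeSet_inter {α β : Type*} (E E' : Set α) (V V' : Set β) :
    nodeSet (E ∩ E') (V ∩ V') = nodeSet E V ∩ nodeSet E' V' := by
  ext a
  cases a <;> rfl

lemma nodeSet_union {α β : Type*} (E E' : Set α) (V V' : Set β) :
    nodeSet (E ∪ E') (V ∪ V') = nodeSet E V ∪ nodeSet E' V' := by
  ext a
  cases a <;> rfl

/-- A subgraph of a tree `S`: a set of vertices and a set of edges which contains every edge adjacent
to one of the chosen vertices, such that the resulting graph is contractible. The induced subgraph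
of the incidence graph of `S` is the incidence graph of that graph. -/
@[ext] structure XiSubgraph (S : XiTree.{u}) where
  verts : Set S.Vertex
  edges : Set S.Edge
  nbhd_subset : ∀ x ∈ verts, S.nbhd x ⊆ edges
  contractible : (S.incidence.induce (nodeSet edges verts)).IsTree

namespace XiSubgraph

variable {S : XiTree.{u}}

lemma isTree_of_connected {A : Set (S.Edge ⊕ S.Vertex)}
    (h : (S.incidence.induce A).Connected) : (S.incidence.induce A).IsTree :=
  ⟨h, S.contractible.isAcyclic.induce A⟩

/-- In a tree, the intersection of two connected sets of nodes is connected if nonempty. -/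
lemma connected_inter {X : Type*} {G : SimpleGraph X} (hG : G.IsTree) {A B : Set X}
    (hA : (G.induce A).Connected) (hB : (G.induce B).Connected) (hAB : (A ∩ B).Nonempty) :
    (G.induce (A ∩ B)).Connected := by
  classical
  obtain ⟨z, hz⟩ := hAB
  have key : ∀ (C : Set X), (G.induce C).Connected → ∀ x ∈ C, ∀ y ∈ C,
      ∃ p : G.Walk x y, p.IsPath ∧ ∀ t ∈ p.support, t ∈ C := by
    intro C hC x hx y hy
    obtain ⟨q, hq⟩ := (hC.preconnected ⟨x, hx⟩ ⟨y, hy⟩).exists_isPath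
    refine ⟨q.map (SimpleGraph.Embedding.induce C).toHom,
      hq.map (SimpleGraph.Embedding.induce (G := G) C).injective, ?_⟩
    intro t ht
    have hs := SimpleGraph.Walk.support_map (SimpleGraph.Embedding.induce (G := G) C).toHom q
    obtain ⟨s, -, hst⟩ := List.mem_map.1 (hs ▸ ht)
    rw [← hst]
    exact s.2
  refine (SimpleGraph.connected_iff _).2 ⟨?_, ⟨⟨z, hz⟩⟩⟩
  rintro ⟨x, hx⟩ ⟨y, hy⟩
  obtain ⟨p, hp, hpA⟩ := key A hA x hx.1 y hy.1
  obtain ⟨q, hq, hqB⟩ := key B hB x hx.2 y hy.2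
  have hpq : p = q := (hG.existsUnique_path x y).unique hp hq
  subst hpq
  exact (p.induce (A ∩ B) fun t ht => ⟨hpA t ht, hqB t ht⟩).reachable

/-- The subgraph consisting of the single edge `e` and no vertex. -/
def single (e : S.Edge) : XiSubgraph S where
  verts := ∅
  edges := {e}
  nbhd_subset := by simp
  contractible := by
    apply isTree_of_connected
    refine (SimpleGraph.connected_iff _).2 ⟨?_, ⟨⟨Sum.inl e, rfl⟩⟩⟩
    rintro ⟨a | a, ha⟩ ⟨b | b, hb⟩
    · obtain rfl : a = e := ha
      obtain rfl : b = a := hb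
      exact SimpleGraph.Reachable.refl _
    · exact hb.elim
    · exact ha.elim
    · exact ha.elim

/-- The subgraph consisting of the vertex `x` and the edges adjacent to it. -/
def star (x : S.Vertex) : XiSubgraph S where
  verts := {x}
  edges := S.nbhd x
  nbhd_subset := by rintro y rfl; exact subset_rfl
  contractible := by
    apply isTree_of_connected
    have hx : (Sum.inr x : S.Edge ⊕ S.Vertex) ∈
        nodeSet (S.nbhd x) {x} := rfl
    have key : ∀ a, (S.incidence.induce (nodeSet (S.nbhd x) {x})).Reachable a ⟨Sum.inr x, hx⟩ := by
      rintro ⟨a | a, ha⟩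
      · apply SimpleGraph.Adj.reachable
        exact S.incidence_adj ha
      · obtain rfl : a = x := ha
        exact SimpleGraph.Reachable.refl _
    exact (SimpleGraph.connected_iff _).2 ⟨fun a b => (key a).trans (key b).symm, ⟨⟨_, hx⟩⟩⟩

/-- Two subgraphs overlap if they have a common edge or a common vertex. -/
def Overlaps (T T' : XiSubgraph S) : Prop :=
  (T.edges ∩ T'.edges).Nonempty ∨ (T.verts ∩ T'.verts).Nonempty

lemma Overlaps.nonempty {T T' : XiSubgraph S} (h : T.Overlaps T') :
    (nodeSet T.edges T.verts ∩ nodeSet T'.edges T'.verts).Nonempty := by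
  rcases h with ⟨e, h⟩ | ⟨x, h⟩
  · exact ⟨Sum.inl e, h⟩
  · exact ⟨Sum.inr x, h⟩

/-- The intersection of two overlapping subgraphs. -/
def inter (T T' : XiSubgraph S) (h : T.Overlaps T') : XiSubgraph S where
  verts := T.verts ∩ T'.verts
  edges := T.edges ∩ T'.edges
  nbhd_subset x hx := Set.subset_inter (T.nbhd_subset x hx.1) (T'.nbhd_subset x hx.2)
  contractible := by
    apply isTree_of_connected
    have hc := connected_inter S.contractible T.contractible.connected
      T'.contractible.connected h.nonempty
    rw [nodeSet_inter]
    exact hc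

/-- The union of two overlapping subgraphs. -/
def union (T T' : XiSubgraph S) (h : T.Overlaps T') : XiSubgraph S where
  verts := T.verts ∪ T'.verts
  edges := T.edges ∪ T'.edges
  nbhd_subset x hx := by
    rcases hx with hx | hx
    · exact (T.nbhd_subset x hx).trans Set.subset_union_left
    · exact (T'.nbhd_subset x hx).trans Set.subset_union_right
  contractible := by
    apply isTree_of_connected
    have hc := SimpleGraph.induce_union_connected T.contractible.connected.preconnected
      T'.contractible.connected.preconnected h.nonempty
    rw [nodeSet_union]
    exact hc

/-- The legs of a subgraph: those of its edges that are adjacent to at most one of its vertices. -/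
def legs (T : XiSubgraph S) : Set S.Edge :=
  {e | e ∈ T.edges ∧ ∀ x ∈ T.verts, ∀ y ∈ T.verts, e ∈ S.nbhd x → e ∈ S.nbhd y → x = y}

open Classical in
/-- The boundary of a subgraph, an unordered list of edges (an element of the free commutative
monoid on the set of edges). It is the list of the legs, each taken once, except that the legs are
taken twice if the subgraph has no vertex, that is, if it is a single edge. -/
def boundary (T : XiSubgraph S) : Multiset S.Edge :=
  if T.verts = ∅ then 2 • (Set.toFinite T.legs).toFinset.val
  else (Set.toFinite T.legs).toFinset.val

/-- A subgraph without vertices is a single edge. -/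
lemma exists_eq_single (T : XiSubgraph S) (h : T.verts = ∅) : ∃ e, T = single e := by
  obtain ⟨⟨a, ha⟩⟩ := T.contractible.connected.nonempty
  have hno : ∀ y : S.Vertex, (Sum.inr y : S.Edge ⊕ S.Vertex) ∉ nodeSet T.edges T.verts := by
    intro y hy
    have hy' : y ∈ T.verts := hy
    simp [h] at hy'
  rcases a with e | y
  · refine ⟨e, ?_⟩
    have hsub : ∀ b, (S.incidence.induce (nodeSet T.edges T.verts)).Reachable ⟨Sum.inl e, ha⟩ b →
        b = ⟨Sum.inl e, ha⟩ := by
      rintro b ⟨p⟩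
      cases p with
      | nil => rfl
      | @cons _ c _ hadj q =>
        exfalso
        have h1 : S.incidence.Adj (Sum.inl e) c.1 := hadj
        rw [LegGraph.incidence, SimpleGraph.fromRel_adj] at h1
        rcases h1.2 with ⟨_, x, _, hc, _⟩ | ⟨_, x, _, hc, _⟩
        · exact hno x (hc ▸ c.2)
        · cases hc
    ext f
    · simp [single, h]
    · constructor
      · intro hf
        have h2 := hsub ⟨Sum.inl f, hf⟩ (T.contractible.connected.preconnected _ _)
        have h3 := congrArg Subtype.val h2
        exact Sum.inl_injective h3
      · rintro rfl
        exact ha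
  · exact (hno y ha).elim

lemma boundary_single (e : S.Edge) : (single e).boundary = {e, e} := by
  have h1 : (Set.toFinite (single e).legs).toFinset = {e} := by
    ext f
    simp [legs, single]
  have h2 : (single e).verts = ∅ := rfl
  rw [boundary, if_pos h2, h1]
  rfl

end XiSubgraph

/-! ### The category of trees -/

/-- A (complete) morphism of trees: a function on edges and a function on subgraphs which are
compatible with boundaries and preserve overlaps, intersections and unions. -/
@[ext] structure XiHom (R S : XiTree.{u}) where
  onEdge : R.Edge → S.Edge
  onSub : XiSubgraph R → XiSubgraph S
  boundary_onSub : ∀ T, (onSub T).boundary = T.boundary.map onEdge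
  overlaps : ∀ T T', T.Overlaps T' → (onSub T).Overlaps (onSub T')
  onSub_inter : ∀ T T' (h : T.Overlaps T'),
    onSub (T.inter T' h) = (onSub T).inter (onSub T') (overlaps T T' h)
  onSub_union : ∀ T T' (h : T.Overlaps T'),
    onSub (T.union T' h) = (onSub T).union (onSub T') (overlaps T T' h)

/-- The category `Ξ` of (unrooted) trees. -/
instance XiTree.category : Category.{u} XiTree.{u} where
  Hom R S := XiHom R S
  id R :=
    { onEdge := id
      onSub := id
      boundary_onSub := fun T => (Multiset.map_id _).symm
      overlaps := fun _ _ h => h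
      onSub_inter := fun _ _ _ => rfl
      onSub_union := fun _ _ _ => rfl }
  comp f g :=
    { onEdge := g.onEdge ∘ f.onEdge
      onSub := g.onSub ∘ f.onSub
      boundary_onSub := fun T => by
        rw [Function.comp_apply, g.boundary_onSub, f.boundary_onSub, Multiset.map_map]
      overlaps := fun _ _ h => g.overlaps _ _ (f.overlaps _ _ h)
      onSub_inter := fun T T' h => by
        simp only [Function.comp_apply, f.onSub_inter T T' h, g.onSub_inter _ _ (f.overlaps _ _ h)]
      onSub_union := fun T T' h => by
        simp only [Function.comp_apply, f.onSub_union T T' h, g.onSub_union _ _ (f.overlaps _ _ h)] }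

/-- The degree of a tree: its number of vertices. -/
def xiDegree (S : XiTree.{u}) : ℕ := Nat.card S.Vertex

/-- The class `Ξ⁺` of the morphisms that are injective on edges. -/
def xiPlus : MorphismProperty XiTree.{u} :=
  fun _ _ (f : XiHom _ _) => Function.Injective f.onEdge

/-- The class `Ξ⁻` of the morphisms that are surjective on edges and such that every vertex of the
target lies in the image of some vertex of the source. -/
def xiMinus : MorphismProperty XiTree.{u} :=
  fun R S (f : XiHom R S) => Function.Surjective f.onEdge ∧
    ∀ y : S.Vertex, ∃ x : R.Vertex, y ∈ (f.onSub (XiSubgraph.star x)).verts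

/-! ### Generalized Reedy categories and EZ-categories -/

section General

variable {C : Type v} [Category.{u} C]

/-- The class of split epimorphisms of a category. -/
def splitEpis (C : Type v) [Category.{u} C] : MorphismProperty C := fun _ _ f => IsSplitEpi f

/-- Wide subcategories `plus` and `minus` and a degree function `d` form a generalized Reedy
structure which is dualizable. -/
structure IsDualizableGeneralizedReedy (plus minus : MorphismProperty C) (d : C → ℕ) : Prop where
  plus_wide : plus.IsMultiplicative
  minus_wide : minus.IsMultiplicative
  lt_of_plus : ∀ {X Y : C} (f : X ⟶ Y), plus f → ¬ IsIso f → d X < d Y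
  lt_of_minus : ∀ {X Y : C} (f : X ⟶ Y), minus f → ¬ IsIso f → d Y < d X
  eq_of_isIso : ∀ {X Y : C} (f : X ⟶ Y), IsIso f → d X = d Y
  plus_and_minus_iff : ∀ {X Y : C} (f : X ⟶ Y), (plus f ∧ minus f) ↔ IsIso f
  exists_factorization : ∀ {X Y : C} (f : X ⟶ Y),
    ∃ (Z : C) (h : X ⟶ Z) (g : Z ⟶ Y), minus h ∧ plus g ∧ h ≫ g = f
  factorization_unique : ∀ {X Y Z Z' : C} (h : X ⟶ Z) (g : Z ⟶ Y) (h' : X ⟶ Z') (g' : Z' ⟶ Y),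
    minus h → plus g → minus h' → plus g' → h ≫ g = h' ≫ g' →
      ∃ θ : Z ≅ Z', h ≫ θ.hom = h' ∧ θ.hom ≫ g' = g
  iso_eq_refl_of_minus : ∀ {X Y : C} (f : X ⟶ Y) (θ : Y ≅ Y),
    minus f → f ≫ θ.hom = f → θ = Iso.refl Y
  iso_eq_refl_of_plus : ∀ {X Y : C} (f : X ⟶ Y) (θ : X ≅ X),
    plus f → θ.hom ≫ f = f → θ = Iso.refl X

/-- A commutative square is an absolute pushout if it is a pushout square and is sent to a pushout
square by every functor to any category. -/
def IsAbsolutePushout {X Y Z P : C} (f : X ⟶ Y) (g : X ⟶ Z) (inl : Y ⟶ P) (inr : Z ⟶ P) : Prop :=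
  IsPushout f g inl inr ∧
    ∀ (D : Type w₁) [Category.{w₂} D] (F : C ⥤ D),
      IsPushout (F.map f) (F.map g) (F.map inl) (F.map inr)

/-- A category with a degree function is an EZ-category (Eilenberg–Zilber category). -/
structure IsEZCategory (C : Type v) [Category.{u} C] (d : C → ℕ) : Prop where
  eq_iff_isIso : ∀ {X Y : C} (f : X ⟶ Y), Mono f → (d X = d Y ↔ IsIso f)
  lt_iff_not_isIso : ∀ {X Y : C} (f : X ⟶ Y), Mono f → (d X < d Y ↔ ¬ IsIso f)
  exists_factorization : ∀ {X Y : C} (f : X ⟶ Y),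
    ∃ (Z : C) (h : X ⟶ Z) (g : Z ⟶ Y), IsSplitEpi h ∧ Mono g ∧ h ≫ g = f
  exists_absolutePushout : ∀ {X Y Z : C} (f : X ⟶ Y) (g : X ⟶ Z), IsSplitEpi f → IsSplitEpi g →
    ∃ (P : C) (inl : Y ⟶ P) (inr : Z ⟶ P), IsAbsolutePushout.{u, v, w₁, w₂} f g inl inr

end General

end

/-!
The proof rests on two facts about subgraphs of a tree `S`.

* A subgraph is determined by its boundary (`XiSubgraph.boundary_injective`); here one needs that
  `S` has a leg. Hence a morphism is determined by its function on edges (`XiHom.ext_onEdge`), and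
  equations between morphisms may be checked on edges. In particular, morphisms that are injective
  on edges are monomorphisms.
* Every subgraph arises from an edge by attaching stars of vertices along single edges
  (`XiSubgraph.induction`). Therefore a morphism is the same as a function on edges and a compatible
  family of images of stars without common vertices (`XiHom.ofStars`,
  `XiHom.disjoint_onSub_star`), and if it is not injective on edges then it collapses a vertex with
  two adjacent edges, which it identifies (`XiHom.exists_collapsed`).

For a vertex with exactly two adjacent edges `a` and `b`, there is a tree in which the vertex is
removed and the two edges are merged, and it is a retract of the original tree: the idempotent sends
`b` to `a` and fixes all other edges (`XiTree.collapseProj`, `XiTree.collapseSection`). A morphism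
that identifies `a` and `b` is fixed by this idempotent, hence factors through the retract. By
induction on the degree, every morphism is a split epimorphism followed by a morphism in `Ξ⁺`.

A morphism that is bijective on edges and covers all vertices maps stars to stars, and so it is an
isomorphism of graphs (`XiTree.isIso_of_plus_of_minus`). With the factorization this identifies `Ξ⁺`
with the monomorphisms and `Ξ⁻` with the split epimorphisms. A morphism in `Ξ⁺` embeds the vertices
of its source into those of its target, by choosing a vertex in the image of each star, which gives
the statements on degrees.

Finally, for two non-invertible split epimorphisms with the same domain, the first collapses can be
chosen such that their idempotents commute (`XiTree.exists_commuting_retractions`). The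
square obtained by splitting the product of two commuting idempotents is an absolute pushout,
because its universal property follows from equations between the retractions and their sections
(`isAbsolutePushout_of_sections`), and pasting such squares gives absolute pushouts in general
(`XiTree.hasSplitPushout`).
-/

noncomputable section

/-! ### Subgraphs of a tree -/

namespace XiSubgraph

variable {S : XiTree.{u}}

lemma incidence_adj_iff {G : LegGraph.{u}} {a b : G.Edge ⊕ G.Vertex} :
    G.incidence.Adj a b ↔
      (∃ e x, a = Sum.inl e ∧ b = Sum.inr x ∧ e ∈ G.nbhd x) ∨
        ∃ e x, b = Sum.inl e ∧ a = Sum.inr x ∧ e ∈ G.nbhd x := by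
  rw [LegGraph.incidence, SimpleGraph.fromRel_adj]
  refine ⟨fun h => h.2, fun h => ⟨?_, h⟩⟩
  rcases h with ⟨e, x, rfl, rfl, -⟩ | ⟨e, x, rfl, rfl, -⟩ <;> simp

/-- If a set of nodes closed under taking neighbourhoods of vertices meets a subgraph `T` but does
not contain it, then one can leave it inside `T` by crossing from an edge to a vertex. -/
lemma exists_exit_of_mem (T : XiSubgraph S) (E : Set S.Edge) (V : Set S.Vertex)
    (hEV : ∀ x ∈ V, S.nbhd x ⊆ E) {a b : S.Edge ⊕ S.Vertex}
    (haT : a ∈ nodeSet T.edges T.verts) (hbT : b ∈ nodeSet T.edges T.verts)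
    (ha : a ∈ nodeSet E V) (hb : b ∉ nodeSet E V) :
    ∃ e ∈ E, ∃ x ∈ T.verts, x ∉ V ∧ e ∈ S.nbhd x := by
  obtain ⟨p⟩ := T.contractible.connected.preconnected ⟨a, haT⟩ ⟨b, hbT⟩
  obtain ⟨d, -, h1, h2⟩ := p.exists_boundary_dart {c | c.1 ∈ nodeSet E V} ha hb
  have hadj : S.incidence.Adj d.fst.1 d.snd.1 := d.adj
  rcases incidence_adj_iff.1 hadj with ⟨e, x, he, hx, hex⟩ | ⟨e, x, he, hx, hex⟩
  · refine ⟨e, ?_, x, ?_, ?_, hex⟩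
    · have h3 : d.fst.1 ∈ nodeSet E V := h1
      rw [he] at h3
      exact h3
    · have := hx ▸ d.snd.2
      exact this
    · intro hxV
      refine h2 (?_ : d.snd.1 ∈ nodeSet E V)
      rw [hx]
      exact hxV
  · refine (h2 (?_ : d.snd.1 ∈ nodeSet E V)).elim
    have h3 : d.fst.1 ∈ nodeSet E V := h1
    rw [hx] at h3
    rw [he]
    exact hEV x h3 hex

/-- A proper subgraph `T'` of `T` can be left inside `T` by crossing from an edge of `T'` to a
vertex outside `T'`. -/
lemma exists_exit {T T' : XiSubgraph S} (hE : T'.edges ⊆ T.edges) (hV : T'.verts ⊆ T.verts)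
    (hne : T' ≠ T) : ∃ e ∈ T'.edges, ∃ x ∈ T.verts, x ∉ T'.verts ∧ e ∈ S.nbhd x := by
  obtain ⟨⟨a, ha⟩⟩ := T'.contractible.connected.nonempty
  have hsub : nodeSet T'.edges T'.verts ⊆ nodeSet T.edges T.verts := by
    rintro (e | x) h
    · exact hE h
    · exact hV h
  have hex : ∃ b ∈ nodeSet T.edges T.verts, b ∉ nodeSet T'.edges T'.verts := by
    by_contra! hcon
    refine hne (XiSubgraph.ext (hV.antisymm fun x hx => ?_) (hE.antisymm fun e he => ?_))
    · exact hcon (Sum.inr x) hx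
    · exact hcon (Sum.inl e) he
  obtain ⟨b, hbT, hb⟩ := hex
  exact exists_exit_of_mem T _ _ T'.nbhd_subset (hsub ha) hbT ha hb

lemma eq_of_verts_subset {T T' : XiSubgraph S} (hE : T'.edges ⊆ T.edges)
    (hV : T'.verts ⊆ T.verts) (hV' : T.verts ⊆ T'.verts) : T' = T := by
  by_contra hne
  obtain ⟨e, -, x, hx, hx', -⟩ := exists_exit hE hV hne
  exact hx' (hV' hx)

lemma exists_vert_of_mem_edges {T : XiSubgraph S} (hT : T.verts.Nonempty) {e : S.Edge}
    (he : e ∈ T.edges) : ∃ x ∈ T.verts, e ∈ S.nbhd x := by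
  have hne : single e ≠ T := by
    rintro rfl
    exact Set.not_nonempty_empty hT
  obtain ⟨f, hf, x, hx, -, hfx⟩ :=
    exists_exit (T' := single e) (T := T) (by rintro _ rfl; exact he) (by simp [single]) hne
  obtain rfl : f = e := hf
  exact ⟨x, hx, hfx⟩

/-- The whole tree, as a subgraph of itself. -/
def whole (S : XiTree.{u}) : XiSubgraph S where
  verts := Set.univ
  edges := Set.univ
  nbhd_subset _ _ := Set.subset_univ _
  contractible := by
    have h : nodeSet (Set.univ : Set S.Edge) (Set.univ : Set S.Vertex) = Set.univ := by
      exact Set.eq_univ_of_forall (by rintro (a | a) <;> trivial)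
    rw [h]
    exact (SimpleGraph.induceUnivIso _).isTree_iff.2 S.contractible

lemma nbhd_nonempty (x : S.Vertex) : (S.nbhd x).Nonempty := by
  obtain ⟨l, -⟩ := S.legs_nonempty
  by_contra hne
  rw [Set.not_nonempty_iff_eq_empty] at hne
  obtain ⟨e, he, -⟩ := exists_exit_of_mem (whole S) ∅ {x} (by rintro y rfl; exact hne.subset)
    (a := Sum.inr x) (b := Sum.inl l) (Set.mem_univ x) (Set.mem_univ l) rfl id
  exact he

lemma edges_nonempty (T : XiSubgraph S) : T.edges.Nonempty := by
  obtain ⟨⟨e | x, h⟩⟩ := T.contractible.connected.nonempty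
  · exact ⟨e, h⟩
  · obtain ⟨e, he⟩ := nbhd_nonempty x
    exact ⟨e, T.nbhd_subset x h he⟩

lemma Overlaps.inter_edges_nonempty {T T' : XiSubgraph S} (h : T.Overlaps T') :
    (T.edges ∩ T'.edges).Nonempty := (T.inter T' h).edges_nonempty

lemma eq_of_mem_edges_of_disjoint {T T' : XiSubgraph S} (hd : Disjoint T.verts T'.verts)
    {e f : S.Edge} (he : e ∈ T.edges) (he' : e ∈ T'.edges) (hf : f ∈ T.edges)
    (hf' : f ∈ T'.edges) : f = e := by
  obtain ⟨g, hg⟩ := exists_eq_single (T.inter T' (Or.inl ⟨e, he, he'⟩))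
    (Set.disjoint_iff_inter_eq_empty.1 hd)
  have hE : T.edges ∩ T'.edges = {g} := congrArg XiSubgraph.edges hg
  have h1 : e ∈ ({g} : Set S.Edge) := hE ▸ ⟨he, he'⟩
  have h2 : f ∈ ({g} : Set S.Edge) := hE ▸ ⟨hf, hf'⟩
  rw [Set.mem_singleton_iff.1 h1, Set.mem_singleton_iff.1 h2]

lemma eq_of_mem_nbhd {x y : S.Vertex} (hxy : x ≠ y) {e f : S.Edge} (he : e ∈ S.nbhd x)
    (he' : e ∈ S.nbhd y) (hf : f ∈ S.nbhd x) (hf' : f ∈ S.nbhd y) : f = e :=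
  eq_of_mem_edges_of_disjoint (T := star x) (T' := star y)
    (Set.disjoint_singleton.2 hxy) he he' hf hf'

lemma inter_eq_single {T T' : XiSubgraph S} (hd : Disjoint T.verts T'.verts)
    {e : S.Edge} (he : e ∈ T.edges) (he' : e ∈ T'.edges) :
    T.inter T' (Or.inl ⟨e, he, he'⟩) = single e := by
  apply XiSubgraph.ext
  · exact Set.disjoint_iff_inter_eq_empty.1 hd
  · ext f
    refine ⟨fun hf => eq_of_mem_edges_of_disjoint hd he he' hf.1 hf.2, ?_⟩
    rintro rfl
    exact ⟨he, he'⟩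

/-- The union of `T` with the star of a vertex `x` that is adjacent to an edge `e` of `T`. -/
def attach (T : XiSubgraph S) (x : S.Vertex) (e : S.Edge) (he : e ∈ T.edges)
    (hex : e ∈ S.nbhd x) : XiSubgraph S :=
  T.union (star x) (Or.inl ⟨e, he, hex⟩)

/-- Every subgraph containing `T₀` is obtained from `T₀` by attaching vertices one at a time. -/
lemma induction_from {P : XiSubgraph S → Prop} (T₀ T : XiSubgraph S)
    (hE : T₀.edges ⊆ T.edges) (hV : T₀.verts ⊆ T.verts) (h₀ : P T₀)
    (attach : ∀ (U : XiSubgraph S) (x : S.Vertex) (e : S.Edge) (he : e ∈ U.edges)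
      (hex : e ∈ S.nbhd x), x ∉ U.verts → x ∈ T.verts → P U → P (U.attach x e he hex)) : P T := by
  obtain ⟨n, hn⟩ : ∃ n, n = (T.verts \ T₀.verts).ncard := ⟨_, rfl⟩
  induction n using Nat.strong_induction_on generalizing T₀ with
  | _ n ih =>
    by_cases hne : T₀ = T
    · exact hne ▸ h₀
    obtain ⟨e, he, x, hx, hx', hex⟩ := exists_exit hE hV hne
    refine ih _ ?_ (T₀.attach x e he hex) (Set.union_subset hE (T.nbhd_subset x hx))
      (Set.union_subset hV (Set.singleton_subset_iff.2 hx)) (attach _ _ _ _ _ hx' hx h₀) rfl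
    rw [hn]
    refine Set.ncard_lt_ncard ⟨?_, ?_⟩ (Set.toFinite _)
    · exact Set.sdiff_subset_sdiff_right Set.subset_union_left
    · intro hsub
      exact (hsub ⟨hx, hx'⟩).2 (Or.inr rfl)

/-- Every subgraph is obtained from a single edge by attaching vertices one at a time. -/
lemma induction {P : XiSubgraph S → Prop} (T : XiSubgraph S) (single : ∀ e, P (single e))
    (attach : ∀ (U : XiSubgraph S) (x : S.Vertex) (e : S.Edge) (he : e ∈ U.edges)
      (hex : e ∈ S.nbhd x), x ∉ U.verts → P U → P (U.attach x e he hex)) : P T := by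
  obtain ⟨e, he⟩ := T.edges_nonempty
  refine induction_from (XiSubgraph.single e) T (by rintro _ rfl; exact he) (Set.empty_subset _)
    (single e) ?_
  intro U x e he hex hx _ hU
  exact attach U x e he hex hx hU

/-- A subgraph that does not contain the vertex `x` can be enlarged, still avoiding `x`, until it has
an edge adjacent to `x`. This reduces statements about arbitrary disjoint subgraphs to the case of
overlapping ones, on which morphisms are controlled. -/
lemma exists_avoiding (T : XiSubgraph S) {x : S.Vertex} (hx : x ∉ T.verts) :
    ∃ U : XiSubgraph S, T.edges ⊆ U.edges ∧ T.verts ⊆ U.verts ∧ x ∉ U.verts ∧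
      ∃ e ∈ U.edges, e ∈ S.nbhd x := by
  by_contra! hcon
  have key : T.edges ⊆ (whole S).edges ∧ T.verts ⊆ (whole S).verts ∧ x ∉ (whole S).verts := by
    refine induction_from
      (P := fun U => T.edges ⊆ U.edges ∧ T.verts ⊆ U.verts ∧ x ∉ U.verts) T (whole S)
      (Set.subset_univ _) (Set.subset_univ _) ⟨subset_rfl, subset_rfl, hx⟩ ?_
    rintro U y e he hey - - ⟨h1, h2, h3⟩
    refine ⟨h1.trans Set.subset_union_left, h2.trans Set.subset_union_left, ?_⟩
    rintro (h | h)
    · exact h3 h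
    · obtain rfl : x = y := h
      exact hcon U h1 h2 h3 e he hey
  exact key.2.2 trivial

/-! ### Boundaries -/

/-- The number of vertices of a subgraph that are adjacent to a given edge. -/
def valence (T : XiSubgraph S) (e : S.Edge) : ℕ := {x | x ∈ T.verts ∧ e ∈ S.nbhd x}.ncard

lemma valence_le_two (T : XiSubgraph S) (e : S.Edge) : T.valence e ≤ 2 :=
  (Set.ncard_le_ncard (fun _ h => h.2) (Set.toFinite _)).trans (S.ncard_le_two e)

lemma valence_eq_zero {T : XiSubgraph S} {e : S.Edge} (he : e ∉ T.edges) : T.valence e = 0 := by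
  rw [valence, Set.ncard_eq_zero (Set.toFinite _)]
  exact Set.eq_empty_of_forall_notMem fun x hx => he (T.nbhd_subset x hx.1 hx.2)

lemma mem_legs_iff {T : XiSubgraph S} {e : S.Edge} :
    e ∈ T.legs ↔ e ∈ T.edges ∧ T.valence e ≤ 1 := by
  rw [valence, Set.ncard_le_one (Set.toFinite _)]
  constructor
  · rintro ⟨h1, h2⟩
    exact ⟨h1, fun x hx y hy => h2 x hx.1 y hy.1 hx.2 hy.2⟩
  · rintro ⟨h1, h2⟩
    exact ⟨h1, fun x hx y hy hex hey => h2 x ⟨hx, hex⟩ y ⟨hy, hey⟩⟩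

open Classical in
/-- Each edge of a subgraph has two sides; those not occupied by a vertex of the subgraph
contribute to the boundary. -/
lemma count_boundary (T : XiSubgraph S) (e : S.Edge) :
    T.boundary.count e = if e ∈ T.edges then 2 - T.valence e else 0 := by
  have hcount : (Set.toFinite T.legs).toFinset.val.count e =
      if e ∈ T.edges ∧ T.valence e ≤ 1 then 1 else 0 := by
    rw [Multiset.count_eq_of_nodup (Finset.nodup _)]
    congr 1
    rw [Finset.mem_val, Set.Finite.mem_toFinset, mem_legs_iff]
  unfold boundary
  split_ifs with h1 h2 h2
  · have h0 : T.valence e = 0 := by simp [valence, h1]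
    rw [Multiset.count_nsmul, hcount]
    simp [h2, h0]
  · rw [Multiset.count_nsmul, hcount]
    simp [h2]
  · obtain ⟨x, hx, hex⟩ := exists_vert_of_mem_edges (Set.nonempty_iff_ne_empty.2 h1) h2
    have h0 : 0 < T.valence e := (Set.ncard_pos (Set.toFinite _)).2 ⟨x, hx, hex⟩
    have h3 := T.valence_le_two e
    rw [hcount]
    split_ifs <;> grind
  · rw [hcount]
    simp [h2]

lemma mem_edges_of_mem_boundary {T : XiSubgraph S} {e : S.Edge} (h : e ∈ T.boundary) :
    e ∈ T.edges := by
  classical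
  by_contra he
  have h1 := Multiset.count_pos.2 h
  rw [count_boundary, if_neg he] at h1
  exact lt_irrefl _ h1

lemma nodup_boundary {T : XiSubgraph S} (h : T.verts.Nonempty) : T.boundary.Nodup := by
  rw [boundary, if_neg h.ne_empty]
  exact Finset.nodup _

lemma verts_nonempty_of_nodup {T : XiSubgraph S} (h : T.boundary.Nodup) : T.verts.Nonempty := by
  by_contra hT
  obtain ⟨e, rfl⟩ := exists_eq_single T (Set.not_nonempty_iff_eq_empty.1 hT)
  rw [boundary_single] at h
  simp at h

lemma mem_boundary_star {x : S.Vertex} {e : S.Edge} : e ∈ (star x).boundary ↔ e ∈ S.nbhd x := by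
  refine ⟨mem_edges_of_mem_boundary, fun he => ?_⟩
  have hne : (star x).verts ≠ ∅ := Set.singleton_ne_empty x
  rw [boundary, if_neg hne, Finset.mem_val, Set.Finite.mem_toFinset]
  exact ⟨he, by rintro y rfl z rfl _ _; rfl⟩

lemma nodup_boundary_star (x : S.Vertex) : (star x).boundary.Nodup :=
  nodup_boundary (Set.singleton_nonempty x)

lemma valence_union {T T' : XiSubgraph S} (h : T.Overlaps T') (hd : Disjoint T.verts T'.verts)
    (e : S.Edge) : (T.union T' h).valence e = T.valence e + T'.valence e := by
  rw [valence, valence, valence, ← Set.ncard_union_eq _ (Set.toFinite _) (Set.toFinite _)]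
  · congr 1
    ext x
    exact or_and_right
  · exact Set.disjoint_left.2 fun x hx hx' => Set.disjoint_left.1 hd hx.1 hx'.1

/-- Gluing two subgraphs along an edge removes both copies of that edge from the boundary. -/
lemma boundary_union {T T' : XiSubgraph S} (hd : Disjoint T.verts T'.verts) {e : S.Edge}
    (he : e ∈ T.edges) (he' : e ∈ T'.edges) :
    (T.union T' (Or.inl ⟨e, he, he'⟩)).boundary + {e, e} = T.boundary + T'.boundary := by
  classical
  ext f
  have hsing : Multiset.count f ({e, e} : Multiset S.Edge) = if f = e then 2 else 0 := by
    have : ({e, e} : Multiset S.Edge) = Multiset.replicate 2 e := rfl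
    rw [this, Multiset.count_replicate]
    simp only [eq_comm]
  have h1 := valence_union (Or.inl ⟨e, he, he'⟩) hd f
  have h2 := valence_le_two (T.union T' (Or.inl ⟨e, he, he'⟩)) f
  have hmem : f ∈ (T.union T' (Or.inl ⟨e, he, he'⟩)).edges ↔ f ∈ T.edges ∨ f ∈ T'.edges := Iff.rfl
  rw [Multiset.count_add, Multiset.count_add, hsing, count_boundary, count_boundary,
    count_boundary]
  by_cases hf : f ∈ T.edges
  · by_cases hf' : f ∈ T'.edges
    · have hfe := eq_of_mem_edges_of_disjoint hd he he' hf hf'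
      rw [if_pos hf, if_pos hf', if_pos hfe, if_pos (hmem.2 (Or.inl hf))]
      omega
    · have hfe : f ≠ e := by rintro rfl; exact hf' he'
      have h0 := valence_eq_zero hf'
      simp only [hmem, hf, hf', hfe, if_true, if_false, true_or] at *
      omega
  · have hfe : f ≠ e := by rintro rfl; exact hf he
    have h0 := valence_eq_zero hf
    by_cases hf' : f ∈ T'.edges
    · simp only [hmem, hf, hf', hfe, if_true, if_false, or_true] at *
      omega
    · simp only [hmem, hf, hf', hfe, if_false, or_false]

/-- Every subgraph of a tree has a leg, because the whole tree has one. -/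
lemma boundary_ne_zero (T : XiSubgraph S) : T.boundary ≠ 0 := by
  classical
  suffices h : ∃ e ∈ T.edges, T.valence e ≤ 1 by
    obtain ⟨e, he, hv⟩ := h
    intro h0
    have h1 := count_boundary T e
    rw [h0, Multiset.count_zero, if_pos he] at h1
    omega
  by_cases hT : T = whole S
  · subst hT
    obtain ⟨l, hl⟩ := S.legs_nonempty
    refine ⟨l, trivial, ?_⟩
    rw [valence, Set.ncard_le_one (Set.toFinite _)]
    intro x hx y hy
    by_contra hxy
    exact hl ⟨x, y, hxy, hx.2, hy.2⟩
  · obtain ⟨e, he, x, -, hxT, hex⟩ :=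
      exists_exit (Set.subset_univ T.edges) (Set.subset_univ T.verts) hT
    refine ⟨e, he, ?_⟩
    have h1 : T.valence e < {y | e ∈ S.nbhd y}.ncard :=
      Set.ncard_lt_ncard ⟨fun _ h => h.2, fun h => hxT (h hex).1⟩ (Set.toFinite _)
    have h2 := S.ncard_le_two e
    omega

/-- If two subgraphs have the same boundary and a common vertex, then the first lies in the second:
an edge through which one could leave the intersection is interior to the one and a leg of the
other. -/
lemma subset_of_boundary_eq {T T' : XiSubgraph S} (h : T.boundary = T'.boundary)
    (hV : (T.verts ∩ T'.verts).Nonempty) : T.inter T' (Or.inr hV) = T := by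
  classical
  by_contra hne
  obtain ⟨e, he, x, hx, hx', hex⟩ := exists_exit (T' := T.inter T' (Or.inr hV)) (T := T)
    Set.inter_subset_left Set.inter_subset_left hne
  obtain ⟨y, hy, hey⟩ := exists_vert_of_mem_edges (T := T.inter T' (Or.inr hV)) hV he
  have hxT' : x ∉ T'.verts := fun h => hx' ⟨hx, h⟩
  have hxy : x ≠ y := by rintro rfl; exact hx' hy
  have h1 : 1 < T.valence e :=
    (Set.one_lt_ncard (Set.toFinite _)).2 ⟨x, ⟨hx, hex⟩, y, ⟨hy.1, hey⟩, hxy⟩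
  have h2 : T'.valence e < {y | e ∈ S.nbhd y}.ncard :=
    Set.ncard_lt_ncard ⟨fun _ h => h.2, fun h => hxT' (h hex).1⟩ (Set.toFinite _)
  have h3 := S.ncard_le_two e
  have h4 := congrArg (Multiset.count e) h
  rw [count_boundary, count_boundary, if_pos he.1, if_pos he.2] at h4
  omega

lemma inter_comm' (T T' : XiSubgraph S) (h : T.Overlaps T') (h' : T'.Overlaps T) :
    T.inter T' h = T'.inter T h' :=
  XiSubgraph.ext (Set.inter_comm _ _) (Set.inter_comm _ _)

/-- A subgraph of a tree is determined by its boundary. Two different subgraphs with the same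
boundary would be glued along all their legs, so they would have exactly one leg, and their union
would be a subgraph with empty boundary; this is excluded because the whole tree has a leg. -/
lemma boundary_injective : Function.Injective (boundary : XiSubgraph S → Multiset S.Edge) := by
  classical
  intro T T' h
  rcases Set.eq_empty_or_nonempty T.verts with hT | hT
  · obtain ⟨e, rfl⟩ := exists_eq_single T hT
    have hT' : T'.verts = ∅ := by
      by_contra hne
      have h1 := nodup_boundary (Set.nonempty_iff_ne_empty.2 hne)
      rw [← h, boundary_single] at h1
      simp at h1
    obtain ⟨f, rfl⟩ := exists_eq_single T' hT'
    rw [boundary_single, boundary_single] at h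
    have h1 : e ∈ ({f, f} : Multiset S.Edge) := h ▸ by simp
    have h2 : e = f := by simpa using h1
    rw [h2]
  have hV : (T.verts ∩ T'.verts).Nonempty := by
    by_contra hV
    have hd : Disjoint T.verts T'.verts :=
      Set.disjoint_iff_inter_eq_empty.2 (Set.not_nonempty_iff_eq_empty.1 hV)
    obtain ⟨e, he⟩ := Multiset.exists_mem_of_ne_zero T.boundary_ne_zero
    have hT1 := mem_edges_of_mem_boundary he
    have hT2 := mem_edges_of_mem_boundary (h ▸ he)
    have hB : T.boundary = {e} := by
      have h1 : ∀ f ∈ T.boundary, f = e := fun f hf =>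
        eq_of_mem_edges_of_disjoint hd hT1 hT2 (mem_edges_of_mem_boundary hf)
          (mem_edges_of_mem_boundary (h ▸ hf))
      have h2 : T.boundary.toFinset = {e} := by
        ext f
        rw [Multiset.mem_toFinset, Finset.mem_singleton]
        exact ⟨h1 f, fun hf => hf ▸ he⟩
      rw [← (nodup_boundary hT).dedup, ← Multiset.toFinset_val, h2]
      rfl
    have hU := boundary_union hd hT1 hT2
    rw [← h, hB] at hU
    have h3 : (T.union T' (Or.inl ⟨e, hT1, hT2⟩)).boundary + {e, e} = 0 + {e, e} := hU
    exact boundary_ne_zero _ (add_right_cancel h3)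
  rw [← subset_of_boundary_eq h hV,
    inter_comm' T T' (Or.inr hV) (Or.inr (by rwa [Set.inter_comm])),
    subset_of_boundary_eq h.symm (by rwa [Set.inter_comm])]

end XiSubgraph

/-! ### Morphisms determined by their values on edges and stars -/

namespace XiHom

open XiSubgraph

variable {R S : XiTree.{u}}

/-- A morphism of trees is determined by its function on edges, because a subgraph is determined by
its boundary. -/
lemma ext_onEdge {f g : XiHom R S} (h : f.onEdge = g.onEdge) : f = g := by
  refine XiHom.ext h (funext fun T => boundary_injective ?_)
  rw [f.boundary_onSub, g.boundary_onSub, h]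

/-- If every vertex of a subgraph is replaced by a subgraph of another tree, compatibly with
boundaries, and if no two of these have a common vertex, then they fit together to a subgraph with
the expected boundary. -/
lemma exists_image (φ : R.Edge → S.Edge) (W : R.Vertex → XiSubgraph S)
    (hb : ∀ x, (W x).boundary = (star x).boundary.map φ)
    (hd : ∀ x y, x ≠ y → Disjoint (W x).verts (W y).verts) (T : XiSubgraph R) :
    ∃ U : XiSubgraph S, U.verts = ⋃ x ∈ T.verts, (W x).verts ∧
      U.edges = φ '' T.edges ∪ ⋃ x ∈ T.verts, (W x).edges ∧
      U.boundary = T.boundary.map φ := by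
  have hφ : ∀ x, ∀ e ∈ R.nbhd x, φ e ∈ (W x).edges := fun x e he =>
    mem_edges_of_mem_boundary (hb x ▸ Multiset.mem_map_of_mem φ (mem_boundary_star.2 he))
  induction T using XiSubgraph.induction with
  | single e =>
    refine ⟨single (φ e), by simp [single], by simp [single], ?_⟩
    rw [boundary_single, boundary_single]
    rfl
  | attach T x e he hex hx ih =>
    obtain ⟨U, hUV, hUE, hUb⟩ := ih
    have heU : φ e ∈ U.edges := hUE ▸ Or.inl ⟨e, he, rfl⟩
    have hdU : Disjoint U.verts (W x).verts := by
      rw [hUV, Set.disjoint_iUnion₂_left]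
      exact fun y hy => hd y x (by rintro rfl; exact hx hy)
    refine ⟨U.union (W x) (Or.inl ⟨φ e, heU, hφ x e hex⟩), ?_, ?_, ?_⟩
    · change U.verts ∪ (W x).verts = ⋃ y ∈ T.verts ∪ {x}, (W y).verts
      rw [hUV, Set.biUnion_union, Set.biUnion_singleton]
    · change U.edges ∪ (W x).edges =
        φ '' (T.edges ∪ R.nbhd x) ∪ ⋃ y ∈ T.verts ∪ {x}, (W y).edges
      have h1 : φ '' R.nbhd x ⊆ (W x).edges := by
        rintro _ ⟨f, hf, rfl⟩
        exact hφ x f hf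
      rw [hUE, Set.biUnion_union, Set.biUnion_singleton, Set.image_union]
      ext f
      have h2 := @h1 f
      simp only [Set.mem_union]
      tauto
    · have h1 := boundary_union hdU heU (hφ x e hex)
      have h2 := congrArg (Multiset.map φ)
        (boundary_union (Set.disjoint_singleton_right.2 hx) he (T' := star x) hex)
      rw [Multiset.map_add, Multiset.map_add, ← hUb, ← hb, ← h1] at h2
      exact (add_right_cancel h2).symm

/-- A morphism given by a function on edges and by its values on the stars of vertices. -/
def ofStars (φ : R.Edge → S.Edge) (W : R.Vertex → XiSubgraph S)
    (hb : ∀ x, (W x).boundary = (star x).boundary.map φ)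
    (hd : ∀ x y, x ≠ y → Disjoint (W x).verts (W y).verts) : XiHom R S where
  onEdge := φ
  onSub T := (exists_image φ W hb hd T).choose
  boundary_onSub T := (exists_image φ W hb hd T).choose_spec.2.2
  overlaps T T' h := by
    obtain ⟨e, he, he'⟩ := h.inter_edges_nonempty
    refine Or.inl ⟨φ e, ?_, ?_⟩
    · rw [(exists_image φ W hb hd T).choose_spec.2.1]
      exact Or.inl ⟨e, he, rfl⟩
    · rw [(exists_image φ W hb hd T').choose_spec.2.1]
      exact Or.inl ⟨e, he', rfl⟩
  onSub_inter T T' h := by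
    have s := (exists_image φ W hb hd T).choose_spec
    have s' := (exists_image φ W hb hd T').choose_spec
    have si := (exists_image φ W hb hd (T.inter T' h)).choose_spec
    apply eq_of_verts_subset
    · refine Set.subset_inter ?_ ?_
      · rw [si.2.1, s.2.1]
        exact Set.union_subset_union (Set.image_mono Set.inter_subset_left)
          (Set.biUnion_subset_biUnion_left Set.inter_subset_left)
      · rw [si.2.1, s'.2.1]
        exact Set.union_subset_union (Set.image_mono Set.inter_subset_right)
          (Set.biUnion_subset_biUnion_left Set.inter_subset_right)
    · refine Set.subset_inter ?_ ?_
      · rw [si.1, s.1]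
        exact Set.biUnion_subset_biUnion_left Set.inter_subset_left
      · rw [si.1, s'.1]
        exact Set.biUnion_subset_biUnion_left Set.inter_subset_right
    · rintro y ⟨hy, hy'⟩
      rw [s.1, Set.mem_iUnion₂] at hy
      rw [s'.1, Set.mem_iUnion₂] at hy'
      obtain ⟨x, hx, hyx⟩ := hy
      obtain ⟨x', hx', hyx'⟩ := hy'
      have hxx : x = x' := by
        by_contra hne
        exact Set.disjoint_left.1 (hd x x' hne) hyx hyx'
      subst hxx
      rw [si.1, Set.mem_iUnion₂]
      exact ⟨x, ⟨hx, hx'⟩, hyx⟩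
  onSub_union T T' h := by
    have s := (exists_image φ W hb hd T).choose_spec
    have s' := (exists_image φ W hb hd T').choose_spec
    have su := (exists_image φ W hb hd (T.union T' h)).choose_spec
    apply XiSubgraph.ext
    · change _ = _ ∪ _
      rw [su.1, s.1, s'.1]
      exact Set.biUnion_union _ _ _
    · change _ = _ ∪ _
      rw [su.2.1, s.2.1, s'.2.1]
      change φ '' (T.edges ∪ T'.edges) ∪ (⋃ x ∈ T.verts ∪ T'.verts, _) = _
      rw [Set.biUnion_union, Set.image_union]
      exact Set.union_union_union_comm _ _ _ _

/-! ### The effect of a morphism on stars -/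

variable (f : XiHom R S)

lemma onSub_single (e : R.Edge) : f.onSub (single e) = single (f.onEdge e) := by
  apply boundary_injective
  rw [f.boundary_onSub, boundary_single, boundary_single]
  rfl

lemma onSub_attach (T : XiSubgraph R) (x : R.Vertex) (e : R.Edge) (he : e ∈ T.edges)
    (hex : e ∈ R.nbhd x) :
    (f.onSub (T.attach x e he hex)).verts =
      (f.onSub T).verts ∪ (f.onSub (star x)).verts := by
  exact congrArg XiSubgraph.verts (f.onSub_union T (star x) (Or.inl ⟨e, he, hex⟩))

lemma mem_verts_onSub {T : XiSubgraph R} {y : S.Vertex} :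
    y ∈ (f.onSub T).verts ↔ ∃ x ∈ T.verts, y ∈ (f.onSub (star x)).verts := by
  induction T using XiSubgraph.induction with
  | single e =>
    rw [onSub_single]
    simp [single]
  | attach T x e he hex hx ih =>
    rw [onSub_attach, Set.mem_union, ih]
    change _ ↔ ∃ z ∈ T.verts ∪ {x}, _
    simp only [Set.union_singleton, Set.exists_mem_insert]
    exact or_comm

lemma onEdge_mem {T : XiSubgraph R} {e : R.Edge} (he : e ∈ T.edges) :
    f.onEdge e ∈ (f.onSub T).edges := by
  have h : T.union (single e) (Or.inl ⟨e, he, rfl⟩) = T :=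
    XiSubgraph.ext (Set.union_empty _) (Set.union_eq_left.2 (Set.singleton_subset_iff.2 he))
  have h1 := f.onSub_union T (single e) (Or.inl ⟨e, he, rfl⟩)
  rw [h] at h1
  have h2 : f.onEdge e ∈ (f.onSub (single e)).edges := by
    rw [f.onSub_single]
    rfl
  rw [h1]
  exact Or.inr h2

lemma mem_edges_onSub_star {x : R.Vertex} {e : R.Edge} (he : e ∈ R.nbhd x) :
    f.onEdge e ∈ (f.onSub (star x)).edges := f.onEdge_mem (T := star x) he

/-- The images of two subgraphs whose intersection is an edge intersect in an edge. -/
lemma onSub_inter_eq_single {T T' : XiSubgraph R} (hd : Disjoint T.verts T'.verts) {e : R.Edge}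
    (he : e ∈ T.edges) (he' : e ∈ T'.edges) :
    Disjoint (f.onSub T).verts (f.onSub T').verts ∧
      (f.onSub T).edges ∩ (f.onSub T').edges = {f.onEdge e} := by
  have h := f.onSub_inter T T' (Or.inl ⟨e, he, he'⟩)
  rw [inter_eq_single hd he he', f.onSub_single] at h
  exact ⟨Set.disjoint_iff_inter_eq_empty.2 (congrArg XiSubgraph.verts h).symm,
    (congrArg XiSubgraph.edges h).symm⟩

lemma disjoint_onSub_star {x y : R.Vertex} (hxy : x ≠ y) :
    Disjoint (f.onSub (star x)).verts (f.onSub (star y)).verts := by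
  obtain ⟨U, -, hU, hyU, e, he, hey⟩ := exists_avoiding (star x) (x := y) (by
    rintro rfl
    exact hxy rfl)
  refine Disjoint.mono_left ?_
    (f.onSub_inter_eq_single (T := U) (T' := star y) (Set.disjoint_singleton_right.2 hyU) he hey).1
  intro z hz
  exact f.mem_verts_onSub.2 ⟨x, hU rfl, hz⟩

/-- An edge of the image of a star that is the image of an arbitrary edge is also the image of an
edge of that star. -/
lemma exists_mem_nbhd_of_onEdge_mem {x : R.Vertex} {e : R.Edge}
    (he : f.onEdge e ∈ (f.onSub (star x)).edges) : ∃ e' ∈ R.nbhd x, f.onEdge e' = f.onEdge e := by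
  obtain ⟨U, hU, -, hxU, e', he', hex⟩ := exists_avoiding (single e) (x := x) id
  have h := (f.onSub_inter_eq_single (T := U) (T' := star x)
    (Set.disjoint_singleton_right.2 hxU) he' hex).2
  have h1 : f.onEdge e ∈ ({f.onEdge e'} : Set S.Edge) := h ▸ ⟨f.onEdge_mem (hU rfl), he⟩
  exact ⟨e', hex, h1.symm⟩

lemma injOn_nbhd {x : R.Vertex} (h : (f.onSub (star x)).verts.Nonempty) :
    Set.InjOn f.onEdge (R.nbhd x) := by
  have h1 := nodup_boundary h
  rw [f.boundary_onSub] at h1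
  intro a ha b hb hab
  exact Multiset.inj_on_of_nodup_map h1 a (mem_boundary_star.2 ha) b (mem_boundary_star.2 hb) hab

/-- A morphism is injective on edges if it collapses no star, since the images of a subgraph and of
an attached star meet only in the image of the common edge. -/
lemma injOn_edges (h : ∀ x, (f.onSub (star x)).verts.Nonempty) (T : XiSubgraph R) :
    Set.InjOn f.onEdge T.edges := by
  induction T using XiSubgraph.induction with
  | single e => exact Set.injOn_singleton _ _
  | attach T x e he hex hx ih =>
    have h2 := (f.onSub_inter_eq_single (T := T) (T' := star x)
      (Set.disjoint_singleton_right.2 hx) he hex).2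
    have key : ∀ a ∈ T.edges, ∀ b ∈ R.nbhd x, f.onEdge a = f.onEdge b → a = b := by
      intro a ha b hb hab
      have h3 : f.onEdge a ∈ ({f.onEdge e} : Set S.Edge) :=
        h2 ▸ ⟨f.onEdge_mem ha, hab ▸ f.mem_edges_onSub_star hb⟩
      have h4 : f.onEdge a = f.onEdge e := h3
      rw [ih ha he h4]
      exact (f.injOn_nbhd (h x) hb hex (hab ▸ h4)).symm
    rintro a (ha | ha) b (hb | hb) hab
    · exact ih ha hb hab
    · exact key a ha b hb hab
    · exact (key b hb a ha hab.symm).symm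
    · exact f.injOn_nbhd (h x) ha hb hab

/-- A morphism that is not injective on edges collapses a vertex with two adjacent edges. -/
lemma exists_collapsed (h : ¬ Function.Injective f.onEdge) :
    ∃ (x : R.Vertex) (a b : R.Edge), a ≠ b ∧ R.nbhd x = {a, b} ∧ f.onEdge a = f.onEdge b := by
  have h1 : ∃ x, ¬ (f.onSub (star x)).verts.Nonempty := by
    by_contra! hcon
    exact h (Set.injOn_univ.1 (f.injOn_edges hcon (whole R)))
  obtain ⟨x, hx⟩ := h1
  obtain ⟨c, hc⟩ := exists_eq_single _ (Set.not_nonempty_iff_eq_empty.1 hx)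
  have hb := f.boundary_onSub (star x)
  rw [hc, boundary_single] at hb
  have hcard : (star x).boundary.card = 2 := by
    rw [← Multiset.card_map f.onEdge, ← hb]
    rfl
  obtain ⟨a, b, hab⟩ := Multiset.card_eq_two.1 hcard
  have hnd := nodup_boundary_star x
  have hmap : ∀ e ∈ (star x).boundary, f.onEdge e = c := by
    intro e he
    have h2 := Multiset.mem_map_of_mem f.onEdge he
    rw [← hb] at h2
    simpa using h2
  refine ⟨x, a, b, ?_, ?_, ?_⟩
  · rintro rfl
    rw [hab] at hnd
    simp at hnd
  · ext e
    rw [← mem_boundary_star, hab]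
    simp
  · rw [hmap a (by simp [hab]), hmap b (by simp [hab])]

end XiHom

/-! ### Isomorphisms -/

namespace XiTree

open XiSubgraph

variable {R S T : XiTree.{u}}

lemma hom_ext {f g : R ⟶ S} (h : ∀ e, XiHom.onEdge f e = XiHom.onEdge g e) : f = g :=
  XiHom.ext_onEdge (funext h)

lemma comp_onEdge (f : R ⟶ S) (g : S ⟶ T) (e : R.Edge) :
    XiHom.onEdge (f ≫ g) e = XiHom.onEdge g (XiHom.onEdge f e) := rfl

lemma boundary_star_of_nbhd_eq (ε : R.Edge → S.Edge) {x : R.Vertex} {y : S.Vertex}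
    (hε : Set.InjOn ε (R.nbhd x)) (h : S.nbhd y = ε '' R.nbhd x) :
    (star y).boundary = (star x).boundary.map ε := by
  rw [(nodup_boundary_star y).ext]
  · intro e
    rw [mem_boundary_star, h, Multiset.mem_map]
    simp only [mem_boundary_star]
    rfl
  · refine (Multiset.nodup_map_iff_inj_on (nodup_boundary_star x)).2 ?_
    intro a ha b hb
    exact hε (mem_boundary_star.1 ha) (mem_boundary_star.1 hb)

/-- The morphism given by an embedding of graphs that is an isomorphism near each vertex. -/
def homOfEmbedding (ε : R.Edge → S.Edge) (ν : R.Vertex → S.Vertex) (hε : Function.Injective ε)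
    (hν : Function.Injective ν) (h : ∀ x, S.nbhd (ν x) = ε '' R.nbhd x) : R ⟶ S :=
  XiHom.ofStars ε (fun x => star (ν x))
    (fun x => boundary_star_of_nbhd_eq ε hε.injOn (h x))
    (fun _ _ hxy => Set.disjoint_singleton.2 (hν.ne hxy))

/-- An isomorphism of the underlying graphs, not necessarily compatible with the orders, is an
isomorphism of trees. -/
def isoOfEquiv (ε : R.Edge ≃ S.Edge) (ν : R.Vertex ≃ S.Vertex)
    (h : ∀ x, S.nbhd (ν x) = ε '' R.nbhd x) : R ≅ S where
  hom := homOfEmbedding ε ν ε.injective ν.injective h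
  inv := homOfEmbedding ε.symm ν.symm ε.symm.injective ν.symm.injective fun y => by
    rw [← ν.apply_symm_apply y, h, ν.apply_symm_apply, ε.symm_image_image]
  hom_inv_id := hom_ext fun e => ε.symm_apply_apply e
  inv_hom_id := hom_ext fun e => ε.apply_symm_apply e

lemma star_verts_nonempty_of_plus {f : R ⟶ S} (hf : xiPlus f) (x : R.Vertex) :
    (XiHom.onSub f (star x)).verts.Nonempty := by
  apply verts_nonempty_of_nodup
  rw [XiHom.boundary_onSub]
  exact (nodup_boundary_star x).map hf

lemma injective_of_mem_onSub_star {f : R ⟶ S} {ν : R.Vertex → S.Vertex}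
    (hν : ∀ x, ν x ∈ (XiHom.onSub f (star x)).verts) : Function.Injective ν := fun x y hxy => by
  by_contra hne
  exact Set.disjoint_left.1 (XiHom.disjoint_onSub_star f hne) (hν x) (hxy ▸ hν y)

/-- If a morphism is surjective on edges, then the image of a star has no inner edges, so it has at
most one vertex. -/
lemma eq_star_of_mem {f : R ⟶ S} (hf : Function.Surjective (XiHom.onEdge f)) {x : R.Vertex}
    {y : S.Vertex} (hy : y ∈ (XiHom.onSub f (star x)).verts) : XiHom.onSub f (star x) = star y := by
  symm
  by_contra hne
  have hyV : (star y).verts ⊆ (XiHom.onSub f (star x)).verts := Set.singleton_subset_iff.2 hy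
  obtain ⟨e, he, z, hz, hzy, hez⟩ :=
    exists_exit (XiSubgraph.nbhd_subset _ y hy : (star y).edges ⊆ _) hyV hne
  have heE := XiSubgraph.nbhd_subset _ y hy he
  -- The edge `e` is in the boundary of the image of the star of `x`, in contradiction to the fact
  -- that `y` and `z` are two vertices of this image adjacent to `e`.
  obtain ⟨e', rfl⟩ := hf e
  obtain ⟨e'', he'', h⟩ := XiHom.exists_mem_nbhd_of_onEdge_mem f heE
  have hB : XiHom.onEdge f e' ∈ (XiHom.onSub f (star x)).boundary := by
    rw [XiHom.boundary_onSub, ← h]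
    exact Multiset.mem_map_of_mem _ (mem_boundary_star.2 he'')
  rw [boundary, if_neg (Set.nonempty_iff_ne_empty.1 ⟨y, hy⟩), Finset.mem_val,
    Set.Finite.mem_toFinset] at hB
  exact hzy (hB.2 z hz y hy hez he)

lemma isIso_of_plus_of_minus {f : R ⟶ S} (hf : xiPlus f) (hf' : xiMinus f) : IsIso f := by
  obtain ⟨hsurj, hvert⟩ := hf'
  choose ν hν using star_verts_nonempty_of_plus hf
  have hstar : ∀ x, XiHom.onSub f (star x) = star (ν x) := fun x => eq_star_of_mem hsurj (hν x)
  have hbij : Function.Bijective ν := by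
    refine ⟨injective_of_mem_onSub_star hν, fun y => ?_⟩
    obtain ⟨x, hx⟩ := hvert y
    rw [hstar x] at hx
    exact ⟨x, hx.symm⟩
  have hnbhd : ∀ x, S.nbhd (ν x) = XiHom.onEdge f '' R.nbhd x := by
    intro x
    ext e
    rw [← mem_boundary_star, ← hstar, XiHom.boundary_onSub, Multiset.mem_map]
    simp only [mem_boundary_star]
    rfl
  have h : f = (isoOfEquiv (Equiv.ofBijective _ ⟨hf, hsurj⟩) (Equiv.ofBijective ν hbij)
    hnbhd).hom := hom_ext fun _ => rfl
  rw [h]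
  infer_instance

lemma xiDegree_le_of_plus {f : R ⟶ S} (hf : xiPlus f) : xiDegree R ≤ xiDegree S := by
  choose ν hν using star_verts_nonempty_of_plus hf
  exact Nat.card_le_card_of_injective ν (injective_of_mem_onSub_star hν)

/-- An edge-injective morphism that preserves the number of vertices sends each star to a star,
hence cannot miss a vertex or an edge. -/
lemma minus_of_plus_of_xiDegree_eq {f : R ⟶ S} (hf : xiPlus f) (hd : xiDegree R = xiDegree S) :
    xiMinus f := by
  choose ν hν using star_verts_nonempty_of_plus hf
  have hbij : Function.Bijective ν :=
    (Nat.bijective_iff_injective_and_card ν).2 ⟨injective_of_mem_onSub_star hν, hd⟩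
  refine ⟨fun e => ?_, fun y => ?_⟩
  · rcases isEmpty_or_nonempty S.Vertex with hS | ⟨⟨y₀⟩⟩
    · obtain ⟨c, hc⟩ := exists_eq_single (whole S) (Set.eq_empty_of_isEmpty _)
      have hE : (Set.univ : Set S.Edge) = {c} := congrArg XiSubgraph.edges hc
      obtain ⟨e', -⟩ := (whole R).edges_nonempty
      have h1 : e ∈ ({c} : Set S.Edge) := hE ▸ trivial
      have h2 : XiHom.onEdge f e' ∈ ({c} : Set S.Edge) := hE ▸ trivial
      exact ⟨e', h2.trans h1.symm⟩
    · obtain ⟨y, -, hey⟩ := exists_vert_of_mem_edges (T := whole S) ⟨y₀, trivial⟩ (Set.mem_univ e)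
      obtain ⟨x, rfl⟩ := hbij.2 y
      have h1 : star (ν x) = XiHom.onSub f (star x) := by
        refine eq_of_verts_subset (XiSubgraph.nbhd_subset _ _ (hν x))
          (Set.singleton_subset_iff.2 (hν x)) fun z hz => ?_
        obtain ⟨x', rfl⟩ := hbij.2 z
        by_cases hxx : x' = x
        · rw [hxx]
          rfl
        · exact (Set.disjoint_left.1 (XiHom.disjoint_onSub_star f hxx) (hν x') hz).elim
      rw [← mem_boundary_star, h1, XiHom.boundary_onSub, Multiset.mem_map] at hey
      obtain ⟨e', -, he'⟩ := hey
      exact ⟨e', he'⟩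
  · obtain ⟨x, rfl⟩ := hbij.2 y
    exact ⟨x, hν x⟩

lemma mono_of_plus {f : R ⟶ S} (hf : xiPlus f) : Mono f :=
  ⟨fun _ _ h => hom_ext fun e => hf (congrArg (fun k => XiHom.onEdge k e) h)⟩

lemma minus_of_isSplitEpi {f : R ⟶ S} (hf : IsSplitEpi f) : xiMinus f := by
  obtain ⟨⟨s, hs⟩⟩ := hf
  have hE : ∀ e, XiHom.onEdge f (XiHom.onEdge s e) = e := fun e =>
    congrArg (fun k => XiHom.onEdge k e) hs
  have hV : ∀ T, XiHom.onSub f (XiHom.onSub s T) = T := fun T =>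
    congrArg (fun k => XiHom.onSub k T) hs
  refine ⟨fun e => ⟨_, hE e⟩, fun y => ?_⟩
  have hy : y ∈ (XiHom.onSub f (XiHom.onSub s (star y))).verts := by
    rw [hV]
    rfl
  obtain ⟨x, -, hx⟩ := (XiHom.mem_verts_onSub f).1 hy
  exact ⟨x, hx⟩

lemma minus_of_comp {f : R ⟶ S} {g : S ⟶ T} (h : xiMinus (f ≫ g)) : xiMinus g := by
  refine ⟨fun e => ?_, fun y => ?_⟩
  · obtain ⟨e', he'⟩ := h.1 e
    exact ⟨_, he'⟩
  · obtain ⟨x, hx⟩ := h.2 y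
    obtain ⟨z, -, hz⟩ := (XiHom.mem_verts_onSub g).1 hx
    exact ⟨z, hz⟩

end XiTree

/-! ### Collapsing a vertex with two adjacent edges -/

namespace LegGraph

lemma card_incidence_edgeSet (G : LegGraph.{u}) :
    Nat.card G.incidence.edgeSet = {p : G.Edge × G.Vertex | p.1 ∈ G.nbhd p.2}.ncard := by
  rw [← Nat.card_coe_set_eq]
  symm
  refine Nat.card_eq_of_bijective
    (fun p : {p : G.Edge × G.Vertex | p.1 ∈ G.nbhd p.2} =>
      (⟨s(Sum.inl p.1.1, Sum.inr p.1.2), G.incidence_adj p.2⟩ : G.incidence.edgeSet)) ⟨?_, ?_⟩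
  · rintro ⟨⟨e, x⟩, h⟩ ⟨⟨e', x'⟩, h'⟩ heq
    have h1 := congrArg Subtype.val heq
    simpa using h1
  · rintro ⟨z, hz⟩
    induction z using Sym2.ind with
    | _ p q =>
      rcases XiSubgraph.incidence_adj_iff.1 hz with ⟨e, x, rfl, rfl, h⟩ | ⟨e, x, rfl, rfl, h⟩
      · exact ⟨⟨(e, x), h⟩, rfl⟩
      · exact ⟨⟨(e, x), h⟩, Subtype.ext Sym2.eq_swap⟩

end LegGraph

namespace XiTree

open XiSubgraph

/-- A contractible graph with a leg, turned into a tree by choosing arbitrary orders. -/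
def ofLegGraph (G : LegGraph.{u}) (hc : G.Contractible) (hl : G.legs.Nonempty) : XiTree.{u} where
  toLegGraph := G
  contractible := hc
  legs_nonempty := hl
  ordAt x := (Finite.equivFinOfCardEq (Nat.card_coe_set_eq (G.nbhd x))).symm
  numLegs := open Classical in if Nonempty G.Vertex then G.legs.ncard else 2
  ord := open Classical in
    if h : Nonempty G.Vertex then fun i =>
      (Finite.equivFinOfCardEq (Nat.card_coe_set_eq G.legs)).symm (Fin.cast (if_pos h) i)
    else fun _ => ⟨hl.some, hl.some_mem⟩
  ord_bijective h := by
    rw [dif_pos h]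
    exact (Equiv.bijective _).comp (finCongr (if_pos h)).bijective
  numLegs_eq_two h := if_neg (not_nonempty_iff.2 h)

section Collapse

variable {R : XiTree.{u}} {x : R.Vertex} {a b : R.Edge}

lemma boundary_star_eq_pair (hab : a ≠ b) (hx : R.nbhd x = {a, b}) :
    (star x).boundary = {a, b} := by
  rw [(nodup_boundary_star x).ext]
  · intro e
    rw [mem_boundary_star, hx]
    simp
  · simpa using hab

/-- An edge adjacent to `x` is adjacent to at most one further vertex. -/
lemma eq_of_mem_nbhd_of_ne {e : R.Edge} (he : e ∈ R.nbhd x) {y z : R.Vertex} (hy : y ≠ x)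
    (hz : z ≠ x) (hey : e ∈ R.nbhd y) (hez : e ∈ R.nbhd z) : y = z := by
  by_contra hne
  have h1 : 2 < {w | e ∈ R.nbhd w}.ncard :=
    (Set.two_lt_ncard (Set.toFinite _)).2 ⟨y, hey, z, hez, x, he, hne, hy, hz⟩
  exact absurd (R.ncard_le_two e) (not_le.2 h1)

open Classical in
/-- The identification of the edge `b` with the edge `a`. -/
def mergeEdge (hab : a ≠ b) (e : R.Edge) : {e : R.Edge // e ≠ b} :=
  if h : e = b then ⟨a, hab⟩ else ⟨e, h⟩

lemma mergeEdge_self (hab : a ≠ b) : mergeEdge hab b = ⟨a, hab⟩ := dif_pos rfl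

lemma mergeEdge_of_ne (hab : a ≠ b) {e : R.Edge} (he : e ≠ b) : mergeEdge hab e = ⟨e, he⟩ :=
  dif_neg he

lemma map_mergeEdge_pair (hab : a ≠ b) :
    ({a, b} : Multiset R.Edge).map (mergeEdge hab) = {⟨a, hab⟩, ⟨a, hab⟩} := by
  rw [Multiset.insert_eq_cons, Multiset.map_cons, Multiset.map_singleton, mergeEdge_self,
    mergeEdge_of_ne hab hab]
  rfl

lemma mergeEdge_eq_iff (hab : a ≠ b) {e : R.Edge} {e' : {e : R.Edge // e ≠ b}} :
    mergeEdge hab e = e' ↔ e = e' ∨ (e = b ∧ e'.1 = a) := by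
  obtain ⟨e', he'⟩ := e'
  by_cases h : e = b
  · subst h
    rw [mergeEdge_self, Subtype.mk.injEq]
    grind
  · rw [mergeEdge_of_ne hab h, Subtype.mk.injEq]
    grind

/-- The graph obtained by removing a vertex `x` whose adjacent edges are `a` and `b`, and merging
these two edges. The merged edge is called `a`. -/
def collapseGraph (hab : a ≠ b) (hx : R.nbhd x = {a, b}) : LegGraph.{u} where
  Edge := {e : R.Edge // e ≠ b}
  Vertex := {y : R.Vertex // y ≠ x}
  finite_edge := inferInstance
  finite_vertex := inferInstance
  nbhd y := mergeEdge hab '' R.nbhd y.1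
  ncard_le_two e := by
    have hax : a ∈ R.nbhd x := hx ▸ Or.inl rfl
    have hbx : b ∈ R.nbhd x := hx ▸ Or.inr rfl
    by_cases hea : e.1 = a
    · have hsub : {y : {y : R.Vertex // y ≠ x} | e ∈ mergeEdge hab '' R.nbhd y.1} ⊆
          {y | a ∈ R.nbhd y.1} ∪ {y | b ∈ R.nbhd y.1} := by
        rintro y ⟨f, hf, hfe⟩
        rcases (mergeEdge_eq_iff hab).1 hfe with h | h
        · left
          have h1 : f = a := h.trans hea
          exact h1 ▸ hf
        · right
          exact h.1 ▸ hf
      have h1 : {y : {y : R.Vertex // y ≠ x} | a ∈ R.nbhd y.1}.ncard ≤ 1 :=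
        (Set.ncard_le_one (Set.toFinite _)).2 fun y hy z hz =>
          Subtype.ext (eq_of_mem_nbhd_of_ne hax y.2 z.2 hy hz)
      have h2 : {y : {y : R.Vertex // y ≠ x} | b ∈ R.nbhd y.1}.ncard ≤ 1 :=
        (Set.ncard_le_one (Set.toFinite _)).2 fun y hy z hz =>
          Subtype.ext (eq_of_mem_nbhd_of_ne hbx y.2 z.2 hy hz)
      calc _ ≤ _ := Set.ncard_le_ncard hsub (Set.toFinite _)
        _ ≤ _ := Set.ncard_union_le _ _
        _ ≤ 2 := by omega
    · refine le_trans ?_ (R.ncard_le_two e.1)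
      rw [← Set.ncard_image_of_injective _ Subtype.val_injective]
      refine Set.ncard_le_ncard ?_ (Set.toFinite _)
      rintro _ ⟨y, ⟨f, hf, hfe⟩, rfl⟩
      rcases (mergeEdge_eq_iff hab).1 hfe with h | h
      · exact h ▸ hf
      · exact (hea h.2).elim

lemma mem_collapseGraph_nbhd (hab : a ≠ b) (hx : R.nbhd x = {a, b})
    {e : (collapseGraph hab hx).Edge} {y : (collapseGraph hab hx).Vertex} :
    e ∈ (collapseGraph hab hx).nbhd y ↔ e.1 ∈ R.nbhd y.1 ∨ (e.1 = a ∧ b ∈ R.nbhd y.1) := by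
  constructor
  · rintro ⟨f, hf, hfe⟩
    rcases (mergeEdge_eq_iff hab).1 hfe with h | h
    · exact Or.inl (h ▸ hf)
    · exact Or.inr ⟨h.2, h.1 ▸ hf⟩
  · rintro (h | h)
    · exact ⟨e.1, h, (mergeEdge_eq_iff hab).2 (Or.inl rfl)⟩
    · exact ⟨b, h.2, (mergeEdge_eq_iff hab).2 (Or.inr ⟨rfl, h.1⟩)⟩

lemma collapseGraph_connected (hab : a ≠ b) (hx : R.nbhd x = {a, b}) :
    (collapseGraph hab hx).incidence.Connected := by
  classical
  let Q := collapseGraph hab hx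
  let m : R.Edge ⊕ R.Vertex → Q.Edge ⊕ Q.Vertex := Sum.elim (fun e => Sum.inl (mergeEdge hab e))
    fun y => if h : y = x then Sum.inl ⟨a, hab⟩ else Sum.inr ⟨y, h⟩
  have hstep : ∀ e y, e ∈ R.nbhd y → Q.incidence.Reachable (m (Sum.inl e)) (m (Sum.inr y)) := by
    intro e y he
    by_cases hy : y = x
    · have h1 : m (Sum.inr y) = Sum.inl ⟨a, hab⟩ := dif_pos hy
      have h2 : m (Sum.inl e) = Sum.inl ⟨a, hab⟩ := by
        refine congrArg Sum.inl ((mergeEdge_eq_iff hab).2 ?_)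
        rw [hy, hx] at he
        exact he.imp id fun h => ⟨h, rfl⟩
      rw [h1, h2]
    · have h1 : m (Sum.inr y) = Sum.inr ⟨y, hy⟩ := dif_neg hy
      rw [h1]
      exact (Q.incidence_adj (x := ⟨y, hy⟩) ⟨e, he, rfl⟩).reachable
  have hwalk : ∀ p q, R.incidence.Walk p q → Q.incidence.Reachable (m p) (m q) := by
    intro p q w
    induction w with
    | nil => exact SimpleGraph.Reachable.refl _
    | cons h _ ih =>
      refine SimpleGraph.Reachable.trans ?_ ih
      rcases incidence_adj_iff.1 h with ⟨e, y, rfl, rfl, hey⟩ | ⟨e, y, rfl, rfl, hey⟩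
      · exact hstep e y hey
      · exact (hstep e y hey).symm
  have hm : Function.Surjective m := by
    rintro (e | y)
    · exact ⟨Sum.inl e.1, congrArg Sum.inl (mergeEdge_of_ne hab e.2)⟩
    · exact ⟨Sum.inr y.1, dif_neg y.2⟩
  refine (SimpleGraph.connected_iff _).2 ⟨fun p q => ?_, ⟨Sum.inl ⟨a, hab⟩⟩⟩
  obtain ⟨p, rfl⟩ := hm p
  obtain ⟨q, rfl⟩ := hm q
  obtain ⟨w⟩ := R.contractible.connected.preconnected p q
  exact hwalk p q w

lemma card_collapseGraph_vertex (hab : a ≠ b) (hx : R.nbhd x = {a, b}) :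
    Nat.card (collapseGraph hab hx).Vertex + 1 = Nat.card R.Vertex := by
  have h := Set.ncard_add_ncard_compl ({x} : Set R.Vertex)
  rw [Set.ncard_singleton, ← Nat.card_coe_set_eq, add_comm] at h
  exact h

/-- Collapsing removes two nodes and at least two edges from the incidence graph, so that the
latter, being connected, remains a tree. -/
lemma collapseGraph_contractible (hab : a ≠ b) (hx : R.nbhd x = {a, b}) :
    (collapseGraph hab hx).Contractible := by
  let Q := collapseGraph hab hx
  refine SimpleGraph.isTree_iff_connected_and_card.2 ⟨collapseGraph_connected hab hx, ?_⟩
  have h1 := (collapseGraph_connected hab hx).card_vert_le_card_edgeSet_add_one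
  have h2 := (SimpleGraph.isTree_iff_connected_and_card.1 R.contractible).2
  have h3 := card_collapseGraph_vertex hab hx
  have h4 : Nat.card (collapseGraph hab hx).Edge + 1 = Nat.card R.Edge := by
    have h := Set.ncard_add_ncard_compl ({b} : Set R.Edge)
    rw [Set.ncard_singleton, ← Nat.card_coe_set_eq, add_comm] at h
    exact h
  rw [LegGraph.card_incidence_edgeSet] at h1 h2 ⊢
  rw [Nat.card_sum] at h1 h2 ⊢
  have h5 : {p : Q.Edge × Q.Vertex | p.1 ∈ Q.nbhd p.2}.ncard ≤
      ({p : R.Edge × R.Vertex | p.1 ∈ R.nbhd p.2} \ {(a, x), (b, x)}).ncard := by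
    choose g hg hg' using fun (p : Q.Edge × Q.Vertex) (hp : p.1 ∈ Q.nbhd p.2) => hp
    refine Set.ncard_le_ncard_of_injOn
      (fun p => open Classical in if hp : p.1 ∈ Q.nbhd p.2 then (g p hp, p.2.1) else (a, x))
      ?_ ?_ (Set.toFinite _)
    · intro p hp
      have hp' : p.1 ∈ Q.nbhd p.2 := hp
      simp only [dif_pos hp']
      refine ⟨hg p hp', ?_⟩
      rintro (h | h)
      · exact p.2.2 (congrArg Prod.snd h)
      · exact p.2.2 (congrArg Prod.snd h)
    · intro p hp q hq hpq
      have hp' : p.1 ∈ Q.nbhd p.2 := hp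
      have hq' : q.1 ∈ Q.nbhd q.2 := hq
      simp only [dif_pos hp', dif_pos hq', Prod.mk.injEq] at hpq
      refine Prod.ext ?_ (Subtype.ext hpq.2)
      rw [← hg' p hp', ← hg' q hq', hpq.1]
  have h6 : ({(a, x), (b, x)} : Set (R.Edge × R.Vertex)).ncard = 2 :=
    Set.ncard_pair (by simpa using hab)
  have h7 : ({(a, x), (b, x)} : Set (R.Edge × R.Vertex)) ⊆ {p | p.1 ∈ R.nbhd p.2} := by
    have hax : a ∈ R.nbhd x := hx ▸ Or.inl rfl
    have hbx : b ∈ R.nbhd x := hx ▸ Or.inr rfl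
    rintro _ (rfl | rfl)
    · exact hax
    · exact hbx
  have h8 := Set.ncard_sdiff_add_ncard_of_subset h7 (Set.toFinite _)
  change _ + 1 = Nat.card Q.Edge + Nat.card Q.Vertex
  change Nat.card Q.Edge + _ = _ at h4
  change Nat.card Q.Vertex + _ = _ at h3
  change Nat.card Q.Edge + Nat.card Q.Vertex ≤ {p : Q.Edge × Q.Vertex | p.1 ∈ Q.nbhd p.2}.ncard + 1
    at h1
  change {p : Q.Edge × Q.Vertex | p.1 ∈ Q.nbhd p.2}.ncard + 1 = _
  omega

lemma collapseGraph_legs_nonempty (hab : a ≠ b) (hx : R.nbhd x = {a, b}) :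
    (collapseGraph hab hx).legs.Nonempty := by
  obtain ⟨l, hl⟩ := R.legs_nonempty
  have hax : a ∈ R.nbhd x := hx ▸ Or.inl rfl
  have hbx : b ∈ R.nbhd x := hx ▸ Or.inr rfl
  refine ⟨mergeEdge hab l, ?_⟩
  rintro ⟨y, z, hyz, hy, hz⟩
  replace hy := (mem_collapseGraph_nbhd hab hx).1 hy
  replace hz := (mem_collapseGraph_nbhd hab hx).1 hz
  have hyz' : y.1 ≠ z.1 := fun h => hyz (Subtype.ext h)
  by_cases hlx : l ∈ R.nbhd x
  · have hly : l ∉ R.nbhd y.1 := fun h => hl ⟨y.1, x, y.2, h, hlx⟩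
    have hlz : l ∉ R.nbhd z.1 := fun h => hl ⟨z.1, x, z.2, h, hlx⟩
    have ha : (mergeEdge hab l).1 = a := by
      have h : mergeEdge hab l = ⟨a, hab⟩ := by
        refine (mergeEdge_eq_iff hab).2 ?_
        rw [hx] at hlx
        exact hlx.imp id fun h => ⟨h, rfl⟩
      rw [h]
    rw [ha] at hy hz
    -- The other one of the edges `a`, `b` is adjacent to both `y` and `z`.
    rw [hx] at hlx
    rcases hlx with rfl | rfl
    · exact hyz' (eq_of_mem_nbhd_of_ne hbx y.2 z.2 (hy.resolve_left hly).2 (hz.resolve_left hlz).2)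
    · exact hyz' (eq_of_mem_nbhd_of_ne hax y.2 z.2 (hy.resolve_right fun h => hly h.2)
        (hz.resolve_right fun h => hlz h.2))
  · have hla : l ≠ a := by rintro rfl; exact hlx hax
    have hlb : l ≠ b := by rintro rfl; exact hlx hbx
    rw [mergeEdge_of_ne hab hlb] at hy hz
    exact hl ⟨y.1, z.1, hyz', hy.resolve_right fun h => hla h.1, hz.resolve_right fun h => hla h.1⟩

/-- The tree obtained by collapsing a vertex with two adjacent edges. -/
def collapse (hab : a ≠ b) (hx : R.nbhd x = {a, b}) : XiTree.{u} :=
  ofLegGraph (collapseGraph hab hx) (collapseGraph_contractible hab hx)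
    (collapseGraph_legs_nonempty hab hx)

lemma xiDegree_collapse (hab : a ≠ b) (hx : R.nbhd x = {a, b}) :
    xiDegree (collapse hab hx) < xiDegree R := by
  have h := card_collapseGraph_vertex hab hx
  change Nat.card (collapseGraph hab hx).Vertex < Nat.card R.Vertex
  omega

lemma injOn_mergeEdge (hab : a ≠ b) (hx : R.nbhd x = {a, b}) {y : R.Vertex} (hy : y ≠ x) :
    Set.InjOn (mergeEdge hab) (R.nbhd y) := by
  have hax : a ∈ R.nbhd x := hx ▸ Or.inl rfl
  have hbx : b ∈ R.nbhd x := hx ▸ Or.inr rfl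
  have key : ¬ (a ∈ R.nbhd y ∧ b ∈ R.nbhd y) := fun h =>
    hab (eq_of_mem_nbhd hy h.2 hbx h.1 hax)
  intro e he f hf h
  have h1 := congrArg Subtype.val h
  by_cases heb : e = b <;> by_cases hfb : f = b
  · rw [heb, hfb]
  · rw [heb, mergeEdge_self, mergeEdge_of_ne hab hfb] at h1
    have h2 : a = f := h1
    exact (key ⟨h2 ▸ hf, heb ▸ he⟩).elim
  · rw [hfb, mergeEdge_self, mergeEdge_of_ne hab heb] at h1
    have h2 : e = a := h1
    exact (key ⟨h2 ▸ he, hfb ▸ hf⟩).elim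
  · rw [mergeEdge_of_ne hab heb, mergeEdge_of_ne hab hfb] at h1
    exact h1

open Classical in
/-- The projection of a tree to its collapse; the star of `x` goes to the merged edge. -/
def collapseProj (hab : a ≠ b) (hx : R.nbhd x = {a, b}) : R ⟶ collapse hab hx :=
  XiHom.ofStars (S := collapse hab hx) (mergeEdge hab)
    (fun y => if h : y = x then single (S := collapse hab hx) ⟨a, hab⟩
      else star (S := collapse hab hx) ⟨y, h⟩)
    (fun y => by
      by_cases h : y = x
      · subst h
        rw [dif_pos rfl, boundary_star_eq_pair hab hx]
        exact (boundary_single (S := collapse hab hx) ⟨a, hab⟩).trans (map_mergeEdge_pair hab).symm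
      · rw [dif_neg h]
        exact boundary_star_of_nbhd_eq (S := collapse hab hx) _ (injOn_mergeEdge hab hx h) rfl)
    (fun y z hyz => by
      by_cases hy : y = x
      · rw [dif_pos hy]
        exact Set.empty_disjoint _
      · by_cases hz : z = x
        · rw [dif_pos hz]
          exact Set.disjoint_empty _
        · rw [dif_neg hy, dif_neg hz]
          exact Set.disjoint_singleton.2 fun h => hyz (congrArg Subtype.val h))

/-- Attaching `x` along `b` to a star replaces the leg `b` by `a`. -/
lemma boundary_attach_collapsed (hab : a ≠ b) (hx : R.nbhd x = {a, b})
    (y : (collapse hab hx).Vertex) (hby : b ∈ R.nbhd y.1) :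
    ((star y.1).attach x b hby (hx ▸ Or.inr rfl)).boundary =
      (star (S := collapse hab hx) y).boundary.map Subtype.val := by
  classical
  have hax : a ∈ R.nbhd x := hx ▸ Or.inl rfl
  have hbx : b ∈ R.nbhd x := hx ▸ Or.inr rfl
  have hay : a ∉ R.nbhd y.1 := fun h => hab (eq_of_mem_nbhd y.2 hby hbx h hax)
  have h1 := boundary_union (T := star y.1) (T' := star x) (Set.disjoint_singleton.2 y.2) hby hbx
  have hB : b ∈ (star y.1).boundary := mem_boundary_star.2 hby
  have h2 : (star (S := collapse hab hx) y).boundary.map Subtype.val =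
      a ::ₘ (star y.1).boundary.erase b := by
    rw [Multiset.Nodup.ext]
    · intro e
      refine Multiset.mem_map.trans ?_
      rw [Multiset.mem_cons, (nodup_boundary_star _).mem_erase_iff, mem_boundary_star]
      constructor
      · rintro ⟨f, hf, rfl⟩
        rcases (mem_collapseGraph_nbhd hab hx).1 (mem_boundary_star.1 hf) with h | h
        · exact Or.inr ⟨f.2, h⟩
        · exact Or.inl h.1
      · rintro (rfl | h)
        · exact ⟨⟨e, hab⟩, mem_boundary_star.2
            ((mem_collapseGraph_nbhd hab hx).2 (Or.inr ⟨rfl, hby⟩)), rfl⟩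
        · exact ⟨⟨e, h.1⟩, mem_boundary_star.2
            ((mem_collapseGraph_nbhd hab hx).2 (Or.inl h.2)), rfl⟩
    · exact (nodup_boundary_star _).map Subtype.val_injective
    · rw [Multiset.nodup_cons]
      exact ⟨fun h => hay (mem_boundary_star.1 (Multiset.mem_of_mem_erase h)),
        (nodup_boundary_star _).erase b⟩
  rw [h2]
  have h3 : (a ::ₘ (star y.1).boundary.erase b) + {b, b} = (star y.1).boundary + {a, b} := by
    conv_rhs => rw [← Multiset.cons_erase hB]
    ext e
    simp only [Multiset.count_add, Multiset.count_cons, Multiset.insert_eq_cons,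
      Multiset.count_singleton]
    omega
  rw [boundary_star_eq_pair hab hx, ← h3] at h1
  exact add_right_cancel h1

open Classical in
/-- A section of the projection to the collapse. It sends the merged edge to `a`; consequently the
star of the vertex on the other side of `b`, if there is one, is sent to the union of its star
with the star of `x`. -/
def collapseSection (hab : a ≠ b) (hx : R.nbhd x = {a, b}) : collapse hab hx ⟶ R :=
  XiHom.ofStars (R := collapse hab hx) Subtype.val
    (fun y => if h : b ∈ R.nbhd y.1 then (star y.1).attach x b h (hx ▸ Or.inr rfl) else star y.1)
    (fun y => by
      by_cases h : b ∈ R.nbhd y.1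
      · rw [dif_pos h]
        exact boundary_attach_collapsed hab hx y h
      · rw [dif_neg h]
        refine boundary_star_of_nbhd_eq (R := collapse hab hx) _ Subtype.val_injective.injOn ?_
        ext e
        constructor
        · intro he
          have heb : e ≠ b := by rintro rfl; exact h he
          exact ⟨⟨e, heb⟩, (mem_collapseGraph_nbhd hab hx).2 (Or.inl he), rfl⟩
        · rintro ⟨f, hf, rfl⟩
          exact ((mem_collapseGraph_nbhd hab hx).1 hf).resolve_right fun h' => h h'.2)
    (fun y z hyz => by
      have hyz' : y.1 ≠ z.1 := fun h => hyz (Subtype.ext h)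
      have hbx : b ∈ R.nbhd x := hx ▸ Or.inr rfl
      by_cases hy : b ∈ R.nbhd y.1 <;> by_cases hz : b ∈ R.nbhd z.1
      · exact (hyz' (eq_of_mem_nbhd_of_ne hbx y.2 z.2 hy hz)).elim
      · rw [dif_pos hy, dif_neg hz]
        refine Set.disjoint_singleton_right.2 ?_
        rintro (h | h)
        · exact hyz' h.symm
        · exact z.2 h
      · rw [dif_neg hy, dif_pos hz]
        refine Set.disjoint_singleton_left.2 ?_
        rintro (h | h)
        · exact hyz' h
        · exact y.2 h
      · rw [dif_neg hy, dif_neg hz]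
        exact Set.disjoint_singleton.2 hyz')

lemma collapseSection_proj (hab : a ≠ b) (hx : R.nbhd x = {a, b}) :
    collapseSection hab hx ≫ collapseProj hab hx = 𝟙 _ :=
  hom_ext fun e => mergeEdge_of_ne hab e.2

lemma collapseProj_section_onEdge_self (hab : a ≠ b) (hx : R.nbhd x = {a, b}) :
    XiHom.onEdge (collapseProj hab hx ≫ collapseSection hab hx) b = a :=
  congrArg Subtype.val (mergeEdge_self hab)

lemma collapseProj_section_onEdge_of_ne (hab : a ≠ b) (hx : R.nbhd x = {a, b}) {e : R.Edge}
    (he : e ≠ b) : XiHom.onEdge (collapseProj hab hx ≫ collapseSection hab hx) e = e :=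
  congrArg Subtype.val (mergeEdge_of_ne hab he)

/-- A morphism that identifies `a` and `b` factors through the collapse. -/
lemma collapse_factorization (hab : a ≠ b) (hx : R.nbhd x = {a, b}) {S : XiTree.{u}} (f : R ⟶ S)
    (hf : XiHom.onEdge f a = XiHom.onEdge f b) :
    (collapseProj hab hx ≫ collapseSection hab hx) ≫ f = f := by
  refine hom_ext fun e => ?_
  rw [comp_onEdge]
  by_cases he : e = b
  · rw [he, collapseProj_section_onEdge_self, hf]
  · rw [collapseProj_section_onEdge_of_ne hab hx he]

end Collapse

end XiTree

/-! ### Absolute pushouts -/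

section General

variable {C : Type v} [Category.{u} C]

/-- A commutative square of split epimorphisms whose sections are compatible in one direction is a
pushout square. -/
lemma isPushout_of_sections {X Y Z P : C} {f : X ⟶ Y} {g : X ⟶ Z} {p : Y ⟶ P} {q : Z ⟶ P}
    {s : Y ⟶ X} {t : Z ⟶ X} {k : P ⟶ Z} (hs : s ≫ f = 𝟙 Y) (ht : t ≫ g = 𝟙 Z) (hk : k ≫ q = 𝟙 P)
    (w : f ≫ p = g ≫ q) (hsk : s ≫ g = p ≫ k) : IsPushout f g p q := by
  refine ⟨⟨w⟩, ⟨Limits.PushoutCocone.IsColimit.mk w (fun c => k ≫ c.inr) (fun c => ?_)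
    (fun c => ?_) (fun c m _ hm => ?_)⟩⟩
  · rw [← Category.assoc, ← hsk, Category.assoc, ← c.condition, ← Category.assoc, hs,
      Category.id_comp]
  · have h1 : g ≫ q ≫ k ≫ c.inr = g ≫ c.inr := by
      rw [← Category.assoc, ← w, Category.assoc, ← Category.assoc p, ← hsk, Category.assoc,
        ← c.condition, ← Category.assoc s, hs, Category.id_comp]
    have h2 := congrArg (fun m => t ≫ m) h1
    simpa only [← Category.assoc, ht, Category.id_comp] using h2
  · rw [← hm, ← Category.assoc, hk, Category.id_comp]

/-- The hypotheses of `isPushout_of_sections` are equations, so they are preserved by all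
functors. -/
lemma isAbsolutePushout_of_sections {X Y Z P : C} {f : X ⟶ Y} {g : X ⟶ Z} {p : Y ⟶ P} {q : Z ⟶ P}
    {s : Y ⟶ X} {t : Z ⟶ X} {k : P ⟶ Z} (hs : s ≫ f = 𝟙 Y) (ht : t ≫ g = 𝟙 Z) (hk : k ≫ q = 𝟙 P)
    (w : f ≫ p = g ≫ q) (hsk : s ≫ g = p ≫ k) : IsAbsolutePushout.{u, v, w₁, w₂} f g p q := by
  refine ⟨isPushout_of_sections hs ht hk w hsk, fun D _ F => ?_⟩
  apply isPushout_of_sections (s := F.map s) (t := F.map t) (k := F.map k) <;>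
    simp only [← F.map_comp, hs, ht, hk, w, hsk, F.map_id]

lemma IsAbsolutePushout.paste_horiz {X₁₁ X₁₂ X₁₃ X₂₁ X₂₂ X₂₃ : C} {h₁₁ : X₁₁ ⟶ X₁₂}
    {h₁₂ : X₁₂ ⟶ X₁₃} {h₂₁ : X₂₁ ⟶ X₂₂} {h₂₂ : X₂₂ ⟶ X₂₃} {v₁₁ : X₁₁ ⟶ X₂₁} {v₁₂ : X₁₂ ⟶ X₂₂}
    {v₁₃ : X₁₃ ⟶ X₂₃} (s : IsAbsolutePushout.{u, v, w₁, w₂} h₁₁ v₁₁ v₁₂ h₂₁)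
    (t : IsAbsolutePushout.{u, v, w₁, w₂} h₁₂ v₁₂ v₁₃ h₂₂) :
    IsAbsolutePushout.{u, v, w₁, w₂} (h₁₁ ≫ h₁₂) v₁₁ v₁₃ (h₂₁ ≫ h₂₂) := by
  refine ⟨s.1.paste_horiz t.1, fun D _ F => ?_⟩
  rw [F.map_comp, F.map_comp]
  exact (s.2 D F).paste_horiz (t.2 D F)

lemma IsAbsolutePushout.paste_vert {X₁₁ X₁₂ X₂₁ X₂₂ X₃₁ X₃₂ : C} {h₁₁ : X₁₁ ⟶ X₁₂}
    {h₂₁ : X₂₁ ⟶ X₂₂} {h₃₁ : X₃₁ ⟶ X₃₂} {v₁₁ : X₁₁ ⟶ X₂₁} {v₁₂ : X₁₂ ⟶ X₂₂} {v₂₁ : X₂₁ ⟶ X₃₁}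
    {v₂₂ : X₂₂ ⟶ X₃₂} (s : IsAbsolutePushout.{u, v, w₁, w₂} h₁₁ v₁₁ v₁₂ h₂₁)
    (t : IsAbsolutePushout.{u, v, w₁, w₂} h₂₁ v₂₁ v₂₂ h₃₁) :
    IsAbsolutePushout.{u, v, w₁, w₂} h₁₁ (v₁₁ ≫ v₂₁) (v₁₂ ≫ v₂₂) h₃₁ := by
  refine ⟨s.1.paste_vert t.1, fun D _ F => ?_⟩
  rw [F.map_comp, F.map_comp]
  exact (s.2 D F).paste_vert (t.2 D F)

/-- Two morphisms with a common domain can be completed to an absolute pushout square in which the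
other two morphisms are split epimorphisms. -/
def HasSplitPushout {X Y Z : C} (f : X ⟶ Y) (g : X ⟶ Z) : Prop :=
  ∃ (P : C) (inl : Y ⟶ P) (inr : Z ⟶ P),
    IsAbsolutePushout.{u, v, w₁, w₂} f g inl inr ∧ IsSplitEpi inl ∧ IsSplitEpi inr

lemma hasSplitPushout_of_isIso_left {X Y Z : C} (f : X ⟶ Y) (g : X ⟶ Z) [IsIso f] [IsSplitEpi g] :
    HasSplitPushout.{u, v, w₁, w₂} f g :=
  ⟨Z, inv f ≫ g, 𝟙 Z, isAbsolutePushout_of_sections (s := inv f) (t := section_ g) (k := 𝟙 Z)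
    (by simp) (by simp) (by simp) (by simp) (by simp), inferInstance, inferInstance⟩

lemma hasSplitPushout_of_isIso_right {X Y Z : C} (f : X ⟶ Y) (g : X ⟶ Z) [IsIso g] [IsSplitEpi f] :
    HasSplitPushout.{u, v, w₁, w₂} f g :=
  ⟨Y, 𝟙 Y, inv g ≫ f, isAbsolutePushout_of_sections (s := section_ f) (t := inv g)
    (k := section_ f ≫ g) (by simp) (by simp) (by simp) (by simp) (by simp), inferInstance,
    inferInstance⟩

/-- If two split epimorphisms have sections such that the resulting idempotents of their common
domain commute, then splitting the product of the idempotents yields an absolute pushout. -/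
lemma hasSplitPushout_of_commute {X Y Z P : C} {f : X ⟶ Y} {g : X ⟶ Z} {s : Y ⟶ X} {t : Z ⟶ X}
    (hs : s ≫ f = 𝟙 Y) (ht : t ≫ g = 𝟙 Z) (h : (f ≫ s) ≫ g ≫ t = (g ≫ t) ≫ f ≫ s)
    {q : Z ⟶ P} {k : P ⟶ Z} (hk : k ≫ q = 𝟙 P) (hq : q ≫ k = t ≫ f ≫ s ≫ g) :
    HasSplitPushout.{u, v, w₁, w₂} f g := by
  have : Mono k := ⟨fun a b hab => by
    have h1 := congrArg (fun m => m ≫ q) hab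
    simpa only [Category.assoc, hk, Category.comp_id] using h1⟩
  have h' : g ≫ t ≫ f ≫ s = f ≫ s ≫ g ≫ t := by simpa only [Category.assoc] using h.symm
  have h'g : g ≫ t ≫ f ≫ s ≫ g = f ≫ s ≫ g := by
    have h1 := congrArg (fun m => m ≫ g) h'
    simpa only [Category.assoc, ht, Category.comp_id] using h1
  have hsk : s ≫ g = (s ≫ g ≫ q) ≫ k := by
    rw [Category.assoc, Category.assoc, hq, h'g, ← Category.assoc, hs, Category.id_comp]
  refine ⟨P, s ≫ g ≫ q, q, isAbsolutePushout_of_sections hs ht hk ?_ hsk, ⟨⟨k ≫ t ≫ f, ?_⟩⟩,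
    ⟨⟨k, hk⟩⟩⟩
  · rw [← cancel_mono k, Category.assoc, ← hsk, Category.assoc, hq, h'g]
  · have h1 : (k ≫ t ≫ f) ≫ s ≫ g ≫ q = k ≫ (t ≫ f ≫ s ≫ g) ≫ q := by
      simp only [Category.assoc]
    rw [h1, ← hq, Category.assoc, hk, Category.comp_id, hk]

end General

/-! ### Monomorphisms and split epimorphisms of trees -/

namespace XiTree

variable {R S T : XiTree.{u}}

/-- Collapsing vertices as long as two edges are identified turns a morphism into one that is
injective on edges. -/
lemma exists_splitEpi_plus (f : R ⟶ S) :
    ∃ (Z : XiTree.{u}) (h : R ⟶ Z) (g : Z ⟶ S), IsSplitEpi h ∧ xiPlus g ∧ h ≫ g = f := by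
  obtain ⟨n, hn⟩ : ∃ n, n = xiDegree R := ⟨_, rfl⟩
  induction n using Nat.strong_induction_on generalizing R with
  | _ n ih =>
    by_cases hf : xiPlus f
    · exact ⟨R, 𝟙 R, f, inferInstance, hf, Category.id_comp f⟩
    obtain ⟨x, a, b, hab, hx, hfab⟩ := XiHom.exists_collapsed f hf
    obtain ⟨Z, h, g, hh, hg, hhg⟩ :=
      ih _ (hn ▸ xiDegree_collapse hab hx) (collapseSection hab hx ≫ f) rfl
    have : IsSplitEpi (collapseProj hab hx) := ⟨⟨_, collapseSection_proj hab hx⟩⟩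
    refine ⟨Z, collapseProj hab hx ≫ h, g, inferInstance, hg, ?_⟩
    rw [Category.assoc, hhg, ← Category.assoc, collapse_factorization hab hx f hfab]

lemma isSplitEpi_of_minus {f : R ⟶ S} (hf : xiMinus f) : IsSplitEpi f := by
  obtain ⟨Z, h, g, hh, hg, rfl⟩ := exists_splitEpi_plus f
  have := isIso_of_plus_of_minus hg (minus_of_comp hf)
  infer_instance

lemma plus_of_mono {f : R ⟶ S} (hf : Mono f) : xiPlus f := by
  by_contra hne
  obtain ⟨x, a, b, hab, hx, hfab⟩ := XiHom.exists_collapsed f hne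
  have h1 := collapse_factorization hab hx f hfab
  have h2 : collapseProj hab hx ≫ collapseSection hab hx = 𝟙 R := by
    rw [← cancel_mono f, h1, Category.id_comp]
  have h3 := collapseProj_section_onEdge_self hab hx
  rw [h2] at h3
  exact hab h3.symm

lemma plus_iff_mono {f : R ⟶ S} : xiPlus f ↔ Mono f := ⟨mono_of_plus, plus_of_mono⟩

lemma minus_iff_isSplitEpi {f : R ⟶ S} : xiMinus f ↔ IsSplitEpi f :=
  ⟨isSplitEpi_of_minus, minus_of_isSplitEpi⟩

lemma plus_and_minus_iff {f : R ⟶ S} : (xiPlus f ∧ xiMinus f) ↔ IsIso f :=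
  ⟨fun h => isIso_of_plus_of_minus h.1 h.2,
    fun _ => ⟨plus_of_mono inferInstance, minus_of_isSplitEpi inferInstance⟩⟩

lemma xiDegree_eq_of_isIso (f : R ⟶ S) [IsIso f] : xiDegree R = xiDegree S :=
  le_antisymm (xiDegree_le_of_plus (plus_of_mono (f := f) inferInstance))
    (xiDegree_le_of_plus (plus_of_mono (f := inv f) inferInstance))

lemma xiDegree_eq_iff {f : R ⟶ S} (hf : xiPlus f) : xiDegree R = xiDegree S ↔ IsIso f :=
  ⟨fun h => isIso_of_plus_of_minus hf (minus_of_plus_of_xiDegree_eq hf h),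
    fun _ => xiDegree_eq_of_isIso f⟩

lemma xiDegree_lt_iff {f : R ⟶ S} (hf : xiPlus f) : xiDegree R < xiDegree S ↔ ¬ IsIso f := by
  rw [← xiDegree_eq_iff hf]
  exact lt_iff_le_and_ne.trans (and_iff_right (xiDegree_le_of_plus hf))

/-- A section of a non-invertible split epimorphism is a non-invertible monomorphism. -/
lemma xiDegree_lt_of_isSplitEpi {f : R ⟶ S} (hf : IsSplitEpi f) (hne : ¬ IsIso f) :
    xiDegree S < xiDegree R := by
  refine (xiDegree_lt_iff (f := section_ f) (plus_of_mono inferInstance)).2 fun h => hne ?_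
  have h1 : f = inv (section_ f) := by
    rw [← cancel_epi (section_ f), IsSplitEpi.id, IsIso.hom_inv_id]
  rw [h1]
  infer_instance

/-! ### Absolute pushouts of split epimorphisms of trees -/

/-- The idempotents given by the collapses of two different vertices commute if the edge removed at
each vertex is not adjacent to the other one. In particular, an edge adjacent to both vertices has
to be kept by both collapses. -/
lemma collapse_commute {x x' : R.Vertex} {a b a' b' : R.Edge} (hab : a ≠ b) (hx : R.nbhd x = {a, b})
    (hab' : a' ≠ b') (hx' : R.nbhd x' = {a', b'}) (hb : b ∉ R.nbhd x') (hb' : b' ∉ R.nbhd x) :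
    (collapseProj hab hx ≫ collapseSection hab hx) ≫
        collapseProj hab' hx' ≫ collapseSection hab' hx' =
      (collapseProj hab' hx' ≫ collapseSection hab' hx') ≫
        collapseProj hab hx ≫ collapseSection hab hx := by
  have h1 : b ≠ a' := fun h => hb (hx' ▸ Or.inl h)
  have h2 : b ≠ b' := fun h => hb (hx' ▸ Or.inr h)
  have h3 : b' ≠ a := fun h => hb' (hx ▸ Or.inl h)
  refine hom_ext fun e => ?_
  rw [comp_onEdge (collapseProj hab hx ≫ collapseSection hab hx),
    comp_onEdge (collapseProj hab' hx' ≫ collapseSection hab' hx')]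
  by_cases he : e = b
  · subst he
    rw [collapseProj_section_onEdge_self, collapseProj_section_onEdge_of_ne hab' hx' h3.symm,
      collapseProj_section_onEdge_of_ne hab' hx' h2, collapseProj_section_onEdge_self]
  · rw [collapseProj_section_onEdge_of_ne hab hx he]
    by_cases he' : e = b'
    · subst he'
      rw [collapseProj_section_onEdge_self, collapseProj_section_onEdge_of_ne hab hx h1.symm]
    · rw [collapseProj_section_onEdge_of_ne hab' hx' he',
        collapseProj_section_onEdge_of_ne hab hx he]

/-- At least one of the two edges at `x` is not adjacent to `x'`; it can be chosen as the edge that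
is removed when `x` is collapsed. -/
lemma exists_pair_notMem {x x' : R.Vertex} (hxx : x ≠ x') {a b : R.Edge} (hab : a ≠ b)
    (hx : R.nbhd x = {a, b}) {S : XiTree.{u}} {f : R ⟶ S}
    (hf : XiHom.onEdge f a = XiHom.onEdge f b) :
    ∃ a b : R.Edge, a ≠ b ∧ R.nbhd x = {a, b} ∧ XiHom.onEdge f a = XiHom.onEdge f b ∧
      b ∉ R.nbhd x' := by
  by_cases hb : b ∈ R.nbhd x'
  · refine ⟨b, a, hab.symm, hx.trans (Set.pair_comm a b), hf.symm, fun ha => hab ?_⟩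
    exact XiSubgraph.eq_of_mem_nbhd hxx (hx ▸ Or.inr rfl) hb (hx ▸ Or.inl rfl) ha
  · exact ⟨a, b, hab, hx, hf, hb⟩

/-- Two non-injective morphisms factor through retractions onto smaller trees whose idempotents
commute. -/
lemma exists_commuting_retractions {f : R ⟶ S} {g : R ⟶ T} (hf : ¬ xiPlus f) (hg : ¬ xiPlus g) :
    ∃ (Y Z : XiTree.{u}) (p : R ⟶ Y) (s : Y ⟶ R) (q : R ⟶ Z) (t : Z ⟶ R),
      s ≫ p = 𝟙 Y ∧ t ≫ q = 𝟙 Z ∧ (p ≫ s) ≫ f = f ∧ (q ≫ t) ≫ g = g ∧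
      xiDegree Y < xiDegree R ∧ xiDegree Z < xiDegree R ∧
      (p ≫ s) ≫ q ≫ t = (q ≫ t) ≫ p ≫ s := by
  obtain ⟨x, a, b, hab, hx, hfab⟩ := XiHom.exists_collapsed f hf
  obtain ⟨x', a', b', hab', hx', hgab⟩ := XiHom.exists_collapsed g hg
  by_cases hxx : x = x'
  · subst hxx
    have hgab' : XiHom.onEdge g a = XiHom.onEdge g b := by
      have hg' : ∀ e ∈ R.nbhd x, XiHom.onEdge g e = XiHom.onEdge g b' := by
        rw [hx']
        rintro e (rfl | rfl)
        · exact hgab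
        · rfl
      rw [hg' a (hx ▸ Or.inl rfl), hg' b (hx ▸ Or.inr rfl)]
    exact ⟨_, _, _, _, _, _, collapseSection_proj hab hx, collapseSection_proj hab hx,
      collapse_factorization hab hx f hfab, collapse_factorization hab hx g hgab',
      xiDegree_collapse hab hx, xiDegree_collapse hab hx, rfl⟩
  · obtain ⟨c, d, hcd, hxc, hfcd, hd⟩ := exists_pair_notMem hxx hab hx hfab
    obtain ⟨c', d', hcd', hxc', hfcd', hd'⟩ := exists_pair_notMem (Ne.symm hxx) hab' hx' hgab
    exact ⟨_, _, _, _, _, _, collapseSection_proj hcd hxc, collapseSection_proj hcd' hxc',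
      collapse_factorization hcd hxc f hfcd, collapse_factorization hcd' hxc' g hfcd',
      xiDegree_collapse hcd hxc, xiDegree_collapse hcd' hxc',
      collapse_commute hcd hxc hcd' hxc' hd hd'⟩

/-- Idempotents split, since every morphism is a split epimorphism followed by a monomorphism. -/
lemma exists_splitting {e : R ⟶ R} (he : e ≫ e = e) :
    ∃ (P : XiTree.{u}) (q : R ⟶ P) (k : P ⟶ R), k ≫ q = 𝟙 P ∧ q ≫ k = e := by
  obtain ⟨P, q, k, hq, hk, rfl⟩ := exists_splitEpi_plus e
  have := mono_of_plus hk
  refine ⟨P, q, k, ?_, rfl⟩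
  rw [← cancel_epi q, ← cancel_mono k]
  simpa only [Category.assoc, Category.comp_id] using he

/-- The square of two commuting retractions onto smaller trees is completed by three pushout squares
over smaller trees, all of which exist by induction on the degree. -/
lemma hasSplitPushout {f : R ⟶ S} {g : R ⟶ T} (hf : IsSplitEpi f) (hg : IsSplitEpi g) :
    HasSplitPushout.{u, u + 1, w₁, w₂} f g := by
  obtain ⟨n, hn⟩ : ∃ n, n = xiDegree R := ⟨_, rfl⟩
  induction n using Nat.strong_induction_on generalizing R S T with
  | _ n ih =>
    by_cases hfp : xiPlus f
    · have := isIso_of_plus_of_minus hfp (minus_of_isSplitEpi hf)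
      exact hasSplitPushout_of_isIso_left f g
    by_cases hgp : xiPlus g
    · have := isIso_of_plus_of_minus hgp (minus_of_isSplitEpi hg)
      exact hasSplitPushout_of_isIso_right f g
    obtain ⟨Y, Z, p, s, q, t, hsp, htq, hpf, hqg, hY, hZ, hcomm⟩ :=
      exists_commuting_retractions hfp hgp
    have hidem : (t ≫ p ≫ s ≫ q) ≫ t ≫ p ≫ s ≫ q = t ≫ p ≫ s ≫ q := by
      have h1 : (t ≫ p ≫ s ≫ q) ≫ t ≫ p ≫ s ≫ q = t ≫ ((p ≫ s) ≫ q ≫ t) ≫ p ≫ s ≫ q := by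
        simp only [Category.assoc]
      have h2 : t ≫ ((q ≫ t) ≫ p ≫ s) ≫ p ≫ s ≫ q =
          (t ≫ q) ≫ t ≫ p ≫ (s ≫ p) ≫ s ≫ q := by
        simp only [Category.assoc]
      rw [h1, hcomm, h2, htq, hsp, Category.id_comp, Category.id_comp]
    obtain ⟨P, r, k, hkr, hrk⟩ := exists_splitting hidem
    obtain ⟨P₁, i₁, j₁, h₁, hi₁, hj₁⟩ :=
      hasSplitPushout_of_commute.{u, u + 1, w₁, w₂} hsp htq hcomm hkr hrk
    -- The morphisms induced by `f` and `g` on the smaller trees, and their pushouts.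
    have hf' : IsSplitEpi (s ≫ f) := ⟨⟨section_ f ≫ p, by
      rw [Category.assoc, ← Category.assoc p, ← Category.assoc, Category.assoc, hpf,
        IsSplitEpi.id]⟩⟩
    have hg' : IsSplitEpi (t ≫ g) := ⟨⟨section_ g ≫ q, by
      rw [Category.assoc, ← Category.assoc q, ← Category.assoc, Category.assoc, hqg,
        IsSplitEpi.id]⟩⟩
    have hP : xiDegree P₁ < n := by
      have h1 : xiDegree P₁ ≤ xiDegree Y :=
        xiDegree_le_of_plus (f := section_ i₁) (plus_of_mono inferInstance)
      omega
    obtain ⟨P₂, i₂, j₂, h₂, hi₂, hj₂⟩ := ih _ (hn ▸ hY) hf' hi₁ rfl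
    obtain ⟨P₃, i₃, j₃, h₃, hi₃, hj₃⟩ := ih _ (hn ▸ hZ) hj₁ hg' rfl
    obtain ⟨P₄, i₄, j₄, h₄, hi₄, hj₄⟩ := ih _ hP hj₂ hi₃ rfl
    have h := (h₁.paste_horiz h₂).paste_vert (h₃.paste_horiz h₄)
    rw [← Category.assoc, hpf, ← Category.assoc, hqg] at h
    exact ⟨P₄, _, _, h, inferInstance, inferInstance⟩

/-! ### Essential smallness -/

/-- A finite code for a graph: its edges and vertices are numbered. -/
abbrev GraphCode : Type := Σ n m : ℕ, Fin m → Set (Fin n)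

/-- A code describes a tree if it arises from numberings of its edges and vertices. -/
def IsCode (R : XiTree.{u}) (c : GraphCode) : Prop :=
  ∃ (ε : R.Edge ≃ Fin c.1) (ν : R.Vertex ≃ Fin c.2.1), ∀ x, c.2.2 (ν x) = ε '' R.nbhd x

lemma exists_isCode (R : XiTree.{u}) : ∃ c, IsCode R c := by
  obtain ⟨n, ⟨ε⟩⟩ := Finite.exists_equiv_fin R.Edge
  obtain ⟨m, ⟨ν⟩⟩ := Finite.exists_equiv_fin R.Vertex
  exact ⟨⟨n, m, fun i => ε '' R.nbhd (ν.symm i)⟩, ε, ν, fun x => by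
    change ε '' R.nbhd (ν.symm (ν x)) = _
    rw [ν.symm_apply_apply]⟩

lemma nonempty_iso_of_isCode {c : GraphCode} (hR : IsCode R c) (hS : IsCode S c) :
    Nonempty (R ≅ S) := by
  obtain ⟨ε, ν, h⟩ := hR
  obtain ⟨ε', ν', h'⟩ := hS
  refine ⟨isoOfEquiv (ε.trans ε'.symm) (ν.trans ν'.symm) fun x => ?_⟩
  have h1 := h' (ν'.symm (ν x))
  rw [ν'.apply_symm_apply, h] at h1
  change S.nbhd (ν'.symm (ν x)) = (fun e => ε'.symm (ε e)) '' R.nbhd x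
  rw [← Set.image_image (fun e => ε'.symm e), h1, Equiv.symm_image_image]

lemma essentiallySmall_xiTree : EssentiallySmall.{u} XiTree.{u} := by
  refine (essentiallySmall_iff _).2 ⟨?_, inferInstance⟩
  choose code hcode using exists_isCode.{u}
  refine small_of_injective (f := fun X : Skeleton XiTree.{u} =>
    code ((fromSkeleton XiTree.{u}).obj X)) fun X Y hXY => ?_
  obtain ⟨i⟩ := nonempty_iso_of_isCode (hcode ((fromSkeleton XiTree.{u}).obj X))
    ((show code _ = code _ from hXY) ▸ hcode ((fromSkeleton XiTree.{u}).obj Y))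
  exact skeleton_skeletal _ ⟨(fromSkeleton XiTree.{u}).preimageIso i⟩

/-! ### The Reedy structure -/

lemma isEZCategory_xiTree : IsEZCategory.{u, u + 1, w₁, w₂} XiTree.{u} xiDegree where
  eq_iff_isIso _ hf := xiDegree_eq_iff (plus_of_mono hf)
  lt_iff_not_isIso _ hf := xiDegree_lt_iff (plus_of_mono hf)
  exists_factorization f := by
    obtain ⟨Z, h, g, hh, hg, hf⟩ := exists_splitEpi_plus f
    exact ⟨Z, h, g, hh, mono_of_plus hg, hf⟩
  exists_absolutePushout f g hf hg := by
    obtain ⟨P, inl, inr, h, -⟩ := hasSplitPushout.{u, w₁, w₂} hf hg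
    exact ⟨P, inl, inr, h⟩

lemma isDualizableGeneralizedReedy_xiTree :
    IsDualizableGeneralizedReedy (C := XiTree.{u}) xiPlus xiMinus xiDegree where
  plus_wide :=
    { id_mem _ := Function.injective_id
      comp_mem _ _ hf hg _ _ h := hf (hg h) }
  minus_wide :=
    { id_mem _ := minus_of_isSplitEpi inferInstance
      comp_mem _ _ hf hg := by
        have := isSplitEpi_of_minus hf
        have := isSplitEpi_of_minus hg
        exact minus_of_isSplitEpi inferInstance }
  lt_of_plus _ hf hne := (xiDegree_lt_iff hf).2 hne
  lt_of_minus _ hf hne := xiDegree_lt_of_isSplitEpi (isSplitEpi_of_minus hf) hne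
  eq_of_isIso f _ := xiDegree_eq_of_isIso f
  plus_and_minus_iff _ := plus_and_minus_iff
  exists_factorization f := by
    obtain ⟨Z, h, g, hh, hg, hf⟩ := exists_splitEpi_plus f
    exact ⟨Z, h, g, minus_of_isSplitEpi hh, hg, hf⟩
  factorization_unique h g h' g' hh hg hh' hg' heq := by
    have := isSplitEpi_of_minus hh
    have := isSplitEpi_of_minus hh'
    have := mono_of_plus hg
    have := mono_of_plus hg'
    have h1 : h ≫ section_ h ≫ h' = h' := by
      rw [← cancel_mono g', Category.assoc, Category.assoc, ← heq, ← Category.assoc (section_ h),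
        IsSplitEpi.id, Category.id_comp]
    have h2 : h' ≫ section_ h' ≫ h = h := by
      rw [← cancel_mono g, Category.assoc, Category.assoc, heq, ← Category.assoc (section_ h'),
        IsSplitEpi.id, Category.id_comp]
    refine ⟨⟨section_ h ≫ h', section_ h' ≫ h, ?_, ?_⟩, h1, ?_⟩
    · rw [Category.assoc, h2, IsSplitEpi.id]
    · rw [Category.assoc, h1, IsSplitEpi.id]
    · rw [Category.assoc, ← heq, ← Category.assoc, IsSplitEpi.id, Category.id_comp]
  iso_eq_refl_of_minus f θ hf hθ := by
    have := isSplitEpi_of_minus hf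
    ext1
    rw [← cancel_epi f, hθ]
    exact (Category.comp_id f).symm
  iso_eq_refl_of_plus f θ hf hθ := by
    have := mono_of_plus hf
    ext1
    rw [← cancel_mono f, hθ]
    exact (Category.id_comp f).symm

end XiTree

end

theorem theorem4p6 :
    EssentiallySmall.{u} XiTree.{u} ∧
    IsEZCategory.{u, u + 1, w₁, w₂} XiTree.{u} xiDegree ∧
    IsDualizableGeneralizedReedy (C := XiTree.{u}) xiPlus xiMinus xiDegree ∧
    xiPlus = MorphismProperty.monomorphisms XiTree.{u} ∧
    xiMinus = splitEpis XiTree.{u} := by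
  refine ⟨XiTree.essentiallySmall_xiTree, XiTree.isEZCategory_xiTree,
    XiTree.isDualizableGeneralizedReedy_xiTree, ?_, ?_⟩
  · ext R S f
    exact XiTree.plus_iff_mono
  · ext R S f
    exact XiTree.minus_iff_isSplitEpi
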